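/- Let $N\ge 1$, let $V=\{1,\dots,N,\delta\}$, and let $W_{ij}=W_{ji}>0$ ($i,j\in V$, $i\ne j$) be symmetric positive weights on the unoriented edges of the complete graph on $V$. For $t=(t_1,\dots,t_N)\in\mathbb{R}^N$ put $t_\delta=0$ and define $$\mathcal{D}_W(t)=\sum_{T}\prod_{(ij)\in T}W_{ij}e^{t_i+t_j},$$ where $T$ runs over the spanning trees of the complete graph on $V$, and $$S^W_{\mathrm{eff}}(t)=\frac12\sum_{i,j\in V}W_{ij}\bigl(\cosh(t_i-t_j)-1\bigr)-\frac12\Bigl(\ln\mathcal{D}_W(t)-2\sum_{i=1}^N t_i\Bigr),$$ where the first sum is over ordered pairs (its diagonal terms vanish). Let $p_1,\dots,p_N\ge 0$ and let $f:\mathbb{R}\to\mathbb{R}$ be convex. Then the integral $$K(W)=\int_{\mathbb{R}^N} f\Bigl(\sum_{i=1}^N p_ie^{t_i}\Bigr)e^{-S^W_{\mathrm{eff}}(t)}\,dt_1\cdots dt_N$$ is well defined in $(-\infty,+\infty]$, that is, the negative part of its integrand has a finite integral, and $K(W)$ is non-increasing in each edge weight $W_{ij}=W_{ji}\in(0,\infty)$,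 $i,j\in V$, when the other weights are kept fixed. -/

import Mathlib

open MeasureTheory

namespace H22

noncomputable section

/-- The vertex set `{1, …, N, δ}`: the root `δ` is `none`, the other vertices are `some k`. -/
abbrev Vertex (N : ℕ) : Type := Option (Fin N)

/-- Weights on unoriented edges; the weight of the edge `(ij) = (ji)` is `W s(i, j)`. -/
abbrev Weight (N : ℕ) : Type := Sym2 (Vertex N) → ℝ

/-- The field `t = (t_1, …, t_N)` extended to all vertices by `t_δ = 0`. -/
def pinned {N : ℕ} (t : Fin N → ℝ) (i : Vertex N) : ℝ := i.elim 0 t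

/-- The factor `W_{ij} e^{t_i + t_j}` of an unoriented edge. -/
def edgeFactor {N : ℕ} (W : Weight N) (t : Fin N → ℝ) (e : Sym2 (Vertex N)) : ℝ :=
  W e * Sym2.lift ⟨fun i j => Real.exp (pinned t i + pinned t j),
    fun i j => by simp only [add_comm]⟩ e

open Classical in
/-- The spanning-tree polynomial `D_W(t)`: the sum over all spanning trees of the complete graph
on `{1, …, N, δ}`, that is, over all trees on this vertex set. -/
def treePoly {N : ℕ} (W : Weight N) (t : Fin N → ℝ) : ℝ :=
  ∑ T : SimpleGraph (Vertex N) with T.IsTree, ∏ e ∈ T.edgeFinset, edgeFactor W t e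

/-- The effective action `S_eff^W(t)`; the first sum is over ordered pairs of vertices. -/
def effAction {N : ℕ} (W : Weight N) (t : Fin N → ℝ) : ℝ :=
  1 / 2 * ∑ i : Vertex N, ∑ j : Vertex N,
      W s(i, j) * (Real.cosh (pinned t i - pinned t j) - 1)
    - 1 / 2 * (Real.log (treePoly W t) - 2 * ∑ k : Fin N, t k)

/-- The integrand `f (∑ p_k e^{t_k}) e^{-S_eff^W(t)}`. -/
def integrand {N : ℕ} (W : Weight N) (p : Fin N → ℝ) (f : ℝ → ℝ) (t : Fin N → ℝ) : ℝ :=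
  f (∑ k : Fin N, p k * Real.exp (t k)) * Real.exp (-effAction W t)

/-- The integral over `ℝ^N` of the positive part of `g`. -/
def posIntegral {N : ℕ} (g : (Fin N → ℝ) → ℝ) : ENNReal := ∫⁻ t, ENNReal.ofReal (g t)

/-- The integral over `ℝ^N` of the negative part of `g`. -/
def negIntegral {N : ℕ} (g : (Fin N → ℝ) → ℝ) : ENNReal := ∫⁻ t, ENNReal.ofReal (-g t)

/-- The Lebesgue integral over `ℝ^N` of a real function, with values in the extended reals
(meaningful when the negative part of the function has a finite integral). -/
def extIntegral {N : ℕ} (g : (Fin N → ℝ) → ℝ) : EReal :=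
  (posIntegral g : EReal) - (negIntegral g : EReal)

/-- The integral `K` as a function of the edge weights. -/
def K {N : ℕ} (p : Fin N → ℝ) (f : ℝ → ℝ) (W : Weight N) : EReal :=
  extIntegral (integrand W p f)

end

end H22

/-! Vary first the weight $w$ of an edge between the root $\delta$ and a vertex $j$. Use as
coordinates $t_j$ and the potentials $y_i=\sum_{v\ne i}W_{iv}e^{t_v-t_i}$, $i\ne j$, which do not
involve $w$. For fixed $y$ these relations are linear in $e^{t}$, so every $e^{t_k}$ is an affine
function of $e^{t_j}$ (`exp_eq_affine`), and M-matrix positivity shows that $t_j$ runs over all of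
$\mathbb{R}$ (`update_mem_range_potentialMap`). The matrix-tree theorem turns $\mathcal{D}_W$ into a
determinant. On a fibre $e^{-S}$ becomes a constant times `igDensity (w + c)`, where $c\ge 0$ is the
effective weight between $j$ and $\delta$ through the other edges (`exp_neg_effAction`). The
Jacobian is constant on the fibre, so there $e^{t_j}$ follows, up to normalization, an inverse
Gaussian law of mean one, and $w$ enters only through its parameter.

These laws have the same mass and mean, and two of their densities cross at exactly two points.
Hence they decrease in the convex order as the parameter grows (`lintegral_convex_igDensity_le`). A
convex function of the field is convex in $e^{t_j}$ on each fibre, and integration over the fibres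
gives `fieldIntegrand_comparison_root`.

For an edge away from the root, replace $f$ by its perspective $F(x)=x_\delta f(\sum_k
p_kx_k/x_\delta)$, which is convex, homogeneous of degree one, and agrees with the original function
when $x_\delta=1$. Pinning the field at $i$ instead of $\delta$ multiplies $e^{-S}$ by $e^{t_i}$ and
$F$ by $e^{-t_i}$ (`fieldIntegrand_repin`). Any vertex may therefore serve as the root.

Positive parts may have infinite integrals, so comparisons are stated with the negative parts moved
to the opposite side. The negative parts are integrable because $f$ has an affine lower bound and
the cosh energy beats every exponential of $|t|$. -/

namespace H22

/-! ### The weighted matrix-tree theorem via parent functions. -/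

section MatrixTree

variable {N : ℕ}

/-- The Laplacian of the complete graph on `Vertex N` with conductances `c`, with the row and the
column of the root `none` removed. -/
def reducedLaplacian (c : Sym2 (Vertex N) → ℝ) : Matrix (Fin N) (Fin N) ℝ :=
  Matrix.of fun i k =>
    (if i = k then ∑ v : Vertex N, c s(some i, v) else 0) - c s(some i, some k)

/-- A parent function is rooted if following it always leads to the root `none`. -/
def IsRooted (g : Fin N → Vertex N) : Prop :=
  ∃ h : Fin N → ℕ, ∀ i k, g i = some k → h k < h i

/-- The matrix `1 - P`, with `P` the incidence matrix of a parent function. -/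
def parentMatrix (g : Fin N → Vertex N) : Matrix (Fin N) (Fin N) ℝ :=
  Matrix.of fun i k => (if i = k then 1 else 0) - (if g i = some k then 1 else 0)

/-- A parent has strictly smaller height, so grouping vertices by height makes the matrix block
triangular with identity blocks on the diagonal. -/
theorem det_parentMatrix_of_isRooted {g : Fin N → Vertex N} (hg : IsRooted g) :
    (parentMatrix g).det = 1 := by
  obtain ⟨h, hh⟩ := hg
  have hne : ∀ i, g i ≠ some i := fun i hi => lt_irrefl _ (hh i i hi)
  have htri : (parentMatrix g).BlockTriangular (fun i => OrderDual.toDual (h i)) := by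
    intro i k hik
    have hik' : h i < h k := hik
    have h1 : i ≠ k := by rintro rfl; exact lt_irrefl _ hik'
    have h2 : g i ≠ some k := fun e => absurd (hh i k e) (by omega)
    simp [parentMatrix, h1, h2]
  rw [htri.det]
  refine Finset.prod_eq_one fun m _ => ?_
  have : (parentMatrix g).toSquareBlock (fun i => OrderDual.toDual (h i)) m = 1 := by
    ext ⟨i, hi⟩ ⟨k, hk⟩
    have h2 : g i ≠ some k := by
      intro e
      have := hh i k e
      have h3 : OrderDual.toDual (h i) = OrderDual.toDual (h k) := hi.trans hk.symm
      have h4 : h i = h k := h3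
      omega
    simp [parentMatrix, Matrix.toSquareBlock_def, Matrix.one_apply, h2]
  rw [this, Matrix.det_one]

/-- Some vertex never reaches the root, for otherwise the hitting time of the root would be a height
function. The indicator of all such vertices lies in the kernel, since a vertex has this property
exactly when its parent does. -/
theorem det_parentMatrix_of_not_isRooted {g : Fin N → Vertex N} (hg : ¬ IsRooted g) :
    (parentMatrix g).det = 0 := by
  classical
  let step : Vertex N → Vertex N := fun v => v.elim none g
  let C : Fin N → Prop := fun k => ∀ n, step^[n] (some k) ≠ none
  have hC : ∃ k, C k := by
    by_contra! hcon
    have hcon' : ∀ k, ∃ n, step^[n] (some k) = none := fun k => by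
      simpa [C] using hcon k
    refine hg ⟨fun k => Nat.find (hcon' k), fun i k hik => ?_⟩
    have hs := Nat.find_spec (hcon' i)
    rcases hn : Nat.find (hcon' i) with _ | n
    · rw [hn] at hs; simp at hs
    · rw [hn, Function.iterate_succ_apply] at hs
      have : step (some i) = some k := hik
      rw [this] at hs
      change Nat.find (hcon' k) < Nat.find (hcon' i)
      rw [hn]
      exact Nat.lt_succ_of_le (Nat.find_min' (hcon' k) hs)
  have hstep : ∀ i, C i ↔ ∃ k, g i = some k ∧ C k := by
    intro i
    constructor
    · intro hi
      rcases hgi : g i with _ | k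
      · exact absurd (show step^[1] (some i) = none from hgi) (hi 1)
      · refine ⟨k, rfl, fun n hn => hi (n + 1) ?_⟩
        rw [Function.iterate_succ_apply]
        rwa [show step (some i) = some k from hgi]
    · rintro ⟨k, hik, hk⟩ n hn
      rcases n with _ | n
      · simp at hn
      · rw [Function.iterate_succ_apply, show step (some i) = some k from hik] at hn
        exact hk n hn
  obtain ⟨k0, hk0⟩ := hC
  refine Matrix.exists_mulVec_eq_zero_iff.1 ⟨fun k => if C k then 1 else 0, ?_, ?_⟩
  · intro h0
    have := congrFun h0 k0
    simp [hk0] at this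
  · ext i
    simp only [Matrix.mulVec, dotProduct, parentMatrix, Matrix.of_apply, sub_mul,
      Finset.sum_sub_distrib, Pi.zero_apply, ite_mul, one_mul, zero_mul, Finset.sum_ite_eq,
      Finset.mem_univ, if_true]
    rcases hgi : g i with _ | k
    · have : ¬ C i := by rw [hstep]; simp [hgi]
      simp [this]
    · have : C i ↔ C k := by rw [hstep]; simp [hgi]
      simp [this]

-- Row $i$ of the Laplacian is the combination, with coefficients $c_{iv}$, of the rows for which
-- $v$ is the parent of $i$. Multilinearity of the determinant expands over all parent functions,
-- and only the rooted ones survive.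
open Classical in
theorem det_reducedLaplacian_eq_sum_isRooted (c : Sym2 (Vertex N) → ℝ) :
    (reducedLaplacian c).det =
      ∑ g : Fin N → Vertex N with IsRooted g, ∏ i, c s(some i, g i) := by
  have hrow : reducedLaplacian c = Matrix.of fun i => ∑ v : Vertex N,
      c s(some i, v) • fun k : Fin N => (if i = k then (1 : ℝ) else 0) -
        (if v = some k then 1 else 0) := by
    ext i k
    simp only [reducedLaplacian, Matrix.of_apply, Finset.sum_apply, Pi.smul_apply, smul_eq_mul,
      mul_sub, Finset.sum_sub_distrib, mul_ite, mul_one, mul_zero, Finset.sum_ite_eq',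
      Finset.mem_univ, if_true]
    split_ifs <;> simp
  rw [hrow]
  change (Matrix.detRowAlternating (R := ℝ) (n := Fin N)).toMultilinearMap _ = _
  change (Matrix.detRowAlternating (R := ℝ) (n := Fin N)).toMultilinearMap
    (fun i => ∑ v : Vertex N, c s(some i, v) • fun k : Fin N => (if i = k then (1 : ℝ) else 0) -
        (if v = some k then 1 else 0)) = _
  rw [MultilinearMap.map_sum, Finset.sum_filter]
  refine Finset.sum_congr rfl fun g _ => ?_
  rw [MultilinearMap.map_smul_univ]
  have : (Matrix.detRowAlternating (R := ℝ) (n := Fin N)).toMultilinearMap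
    (fun i k : Fin N => (if i = k then (1 : ℝ) else 0) - (if g i = some k then 1 else 0))
      = (parentMatrix g).det := rfl
  rw [this]
  split_ifs with hg
  · rw [det_parentMatrix_of_isRooted hg, smul_eq_mul, mul_one]
  · rw [det_parentMatrix_of_not_isRooted hg, smul_zero]

/-- The graph whose edges join every vertex to its parent. -/
def parentGraph (g : Fin N → Vertex N) : SimpleGraph (Vertex N) :=
  SimpleGraph.fromEdgeSet (Set.range fun i => s(some i, g i))

theorem IsRooted.ne {g : Fin N → Vertex N} (hg : IsRooted g) (i : Fin N) : g i ≠ some i := by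
  obtain ⟨h, hh⟩ := hg
  exact fun hi => lt_irrefl _ (hh i i hi)

theorem IsRooted.edgeSet_parentGraph {g : Fin N → Vertex N} (hg : IsRooted g) :
    (parentGraph g).edgeSet = Set.range fun i => s(some i, g i) := by
  rw [parentGraph, SimpleGraph.edgeSet_fromEdgeSet, sdiff_eq_left, Set.disjoint_left]
  rintro _ ⟨i, rfl⟩ hi
  exact hg.ne i (by simpa [eq_comm] using hi)

theorem IsRooted.adj {g : Fin N → Vertex N} (hg : IsRooted g) (i : Fin N) :
    (parentGraph g).Adj (some i) (g i) := by
  rw [← SimpleGraph.mem_edgeSet, hg.edgeSet_parentGraph]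
  exact ⟨i, rfl⟩

theorem IsRooted.connected {g : Fin N → Vertex N} (hg : IsRooted g) :
    (parentGraph g).Connected := by
  have hg' := hg
  obtain ⟨h, hh⟩ := hg
  have key : ∀ n, ∀ i, h i = n → (parentGraph g).Reachable (some i) none := by
    intro n
    induction n using Nat.strong_induction_on with
    | _ n ih =>
      intro i hi
      have h1 := (hg'.adj i).reachable
      rcases hgi : g i with _ | k
      · rwa [hgi] at h1
      · rw [hgi] at h1
        exact h1.trans (ih (h k) (hi ▸ hh i k hgi) k rfl)
  have key' : ∀ v, (parentGraph g).Reachable v none := by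
    rintro (_ | i)
    · exact SimpleGraph.Reachable.refl _
    · exact key _ i rfl
  exact { preconnected := fun u v => (key' u).trans (key' v).symm }

theorem IsRooted.isTree {g : Fin N → Vertex N} (hg : IsRooted g) : (parentGraph g).IsTree := by
  rw [SimpleGraph.isTree_iff_connected_and_card]
  refine ⟨hg.connected, le_antisymm ?_ hg.connected.card_vert_le_card_edgeSet_add_one⟩
  rw [hg.edgeSet_parentGraph]
  have := Finite.card_range_le fun i : Fin N => s(some i, g i)
  simp at this ⊢
  exact this

theorem IsRooted.injective_edge {g : Fin N → Vertex N} (hg : IsRooted g) :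
    Function.Injective fun i => s(some i, g i) := by
  have h := (SimpleGraph.isTree_iff_connected_and_card.1 hg.isTree).2
  rw [hg.edgeSet_parentGraph] at h
  rw [← Set.injOn_univ]
  refine Set.injOn_of_ncard_image_eq ?_
  rw [Set.image_univ, ← Nat.card_coe_set_eq, Set.ncard_univ]
  simp at h ⊢
  exact h

/-- A tree determines its orientation towards the root. If the edge from $i$ to its parent under `g`
were oriented the other way by `g'`, induction on the height would make $i$ the parent of its own
parent. -/
theorem parentGraph_injOn : Set.InjOn (parentGraph (N := N)) {g | IsRooted g} := by
  intro g hg g' hg' hgg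
  by_contra hne
  obtain ⟨h, hh⟩ := id hg
  have hE : (Set.range fun i => s(some i, g i)) = Set.range fun i => s(some i, g' i) := by
    rw [← IsRooted.edgeSet_parentGraph hg, ← IsRooted.edgeSet_parentGraph hg', hgg]
  have key : ∀ n, ∀ i, h i = n → g i = g' i := by
    intro n
    induction n using Nat.strong_induction_on with
    | _ n ih =>
      intro i hi
      obtain ⟨k, hk⟩ : s(some i, g i) ∈ Set.range fun i => s(some i, g' i) := hE ▸ ⟨i, rfl⟩
      simp only [Sym2.eq_iff, Option.some.injEq] at hk
      rcases hk with ⟨rfl, hk⟩ | ⟨h1, h2⟩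
      · exact hk.symm
      · have h3 := hh i k h1.symm
        have h4 := ih _ (hi ▸ h3) k rfl
        have h5 := hh k i (h4.trans h2)
        omega
  exact hne (funext fun i => key _ i rfl)

/-- The parent of a vertex is its successor on a geodesic to the root, with the distance as height.
The resulting tree is contained in `T` and has the same number of edges. -/
theorem exists_parentGraph_eq {T : SimpleGraph (Vertex N)} (hT : T.IsTree) :
    ∃ g, IsRooted g ∧ parentGraph g = T := by
  have hex : ∀ i : Fin N, ∃ v, T.Adj (some i) v ∧ T.dist v none < T.dist (some i) none := by
    intro i
    obtain ⟨p, hp⟩ := hT.connected.exists_walk_length_eq_dist (some i) none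
    cases p with
    | cons hadj q =>
      refine ⟨_, hadj, ?_⟩
      rw [← hp, SimpleGraph.Walk.length_cons]
      exact Nat.lt_succ_of_le (SimpleGraph.dist_le q)
  choose g hadj hlt using hex
  have hg : IsRooted g := by
    refine ⟨fun i => T.dist (some i) none, fun i k hik => ?_⟩
    have := hlt i
    rwa [hik] at this
  refine ⟨g, hg, ?_⟩
  rw [← SimpleGraph.edgeSet_inj]
  refine Set.eq_of_subset_of_ncard_le ?_ ?_
  · rw [hg.edgeSet_parentGraph]
    rintro _ ⟨i, rfl⟩
    exact hadj i
  · have h1 := (SimpleGraph.isTree_iff_connected_and_card.1 hT).2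
    have h2 := (SimpleGraph.isTree_iff_connected_and_card.1 hg.isTree).2
    rw [← Nat.card_coe_set_eq, ← Nat.card_coe_set_eq]
    omega

open Classical in
/-- The weighted matrix-tree theorem for the complete graph. -/
theorem sum_isTree_eq_det_reducedLaplacian (c : Sym2 (Vertex N) → ℝ) :
    ∑ T : SimpleGraph (Vertex N) with T.IsTree, ∏ e ∈ T.edgeFinset, c e =
      (reducedLaplacian c).det := by
  rw [det_reducedLaplacian_eq_sum_isRooted]
  symm
  refine Finset.sum_bij (fun g _ => parentGraph g) ?_ ?_ ?_ ?_
  · intro g hg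
    simp only [Finset.mem_filter, Finset.mem_univ, true_and] at hg ⊢
    exact hg.isTree
  · intro g hg g' hg' h
    simp only [Finset.mem_filter, Finset.mem_univ, true_and] at hg hg'
    exact parentGraph_injOn hg hg' h
  · intro T hT
    simp only [Finset.mem_filter, Finset.mem_univ, true_and] at hT
    obtain ⟨g, hg, rfl⟩ := exists_parentGraph_eq hT
    exact ⟨g, by simpa using hg, rfl⟩
  · intro g hg
    simp only [Finset.mem_filter, Finset.mem_univ, true_and] at hg
    have : (parentGraph g).edgeFinset = Finset.univ.image fun i => s(some i, g i) := by
      ext e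
      rw [SimpleGraph.mem_edgeFinset, hg.edgeSet_parentGraph]
      simp
    rw [this, Finset.prod_image fun i _ k _ h => hg.injective_edge h]

end MatrixTree

theorem treePoly_eq_det {N : ℕ} (W : Weight N) (t : Fin N → ℝ) :
    treePoly W t = (reducedLaplacian (edgeFactor W t)).det :=
  sum_isTree_eq_det_reducedLaplacian _

/-! ### Inverse Gaussian laws and the convex order. -/

section ConvexOrder

/-- Up to the factor `√(2π)`, the density of the field at a vertex joined to the root by an edge
of weight `η`. -/
noncomputable def igDensity (η τ : ℝ) : ℝ :=
  Real.sqrt η * Real.exp (-τ / 2) * Real.exp (-(η * (Real.cosh τ - 1)))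

theorem igDensity_nonneg (η τ : ℝ) : 0 ≤ igDensity η τ := by
  unfold igDensity; positivity

theorem continuous_igDensity (η : ℝ) : Continuous (igDensity η) := by
  unfold igDensity; fun_prop

theorem hasDerivAt_two_mul_sinh_half (τ : ℝ) :
    HasDerivAt (fun τ : ℝ => 2 * Real.sinh (τ / 2)) (Real.cosh (τ / 2)) τ := by
  have h := ((hasDerivAt_id' τ).div_const 2).sinh.const_mul 2
  rwa [show 2 * (Real.cosh (τ / 2) * (1 / 2)) = Real.cosh (τ / 2) by ring] at h

theorem injective_two_mul_sinh_half : Function.Injective fun τ : ℝ => 2 * Real.sinh (τ / 2) := by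
  intro x y h
  have h1 : Real.sinh (x / 2) = Real.sinh (y / 2) := by simpa using h
  have := Real.sinh_injective h1
  linarith

theorem range_two_mul_sinh_half : Set.range (fun τ : ℝ => 2 * Real.sinh (τ / 2)) = Set.univ := by
  refine Set.eq_univ_of_forall fun u => ?_
  obtain ⟨x, hx⟩ := Real.sinh_surjective (u / 2)
  exact ⟨2 * x, by simp only [mul_div_cancel_left₀ x (two_ne_zero' ℝ), hx]; ring⟩

theorem half_mul_two_mul_sinh_half_sq (τ : ℝ) :
    (2 * Real.sinh (τ / 2)) ^ 2 / 2 = Real.cosh τ - 1 := by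
  have h := Real.cosh_two_mul (τ / 2)
  rw [Real.cosh_sq] at h
  rw [show 2 * (τ / 2) = τ by ring] at h
  rw [h]; ring

/-- The substitution $u=2\sinh(\tau/2)$ turns $\cosh\tau-1$ into $u^2/2$ and the integral into a
Gaussian one. -/
theorem integrable_cosh_half_mul {η : ℝ} (hη : 0 < η) :
    Integrable fun τ : ℝ => Real.cosh (τ / 2) * Real.exp (-(η * (Real.cosh τ - 1))) := by
  have h := (integrableOn_image_iff_integrableOn_abs_deriv_smul (s := Set.univ)
    MeasurableSet.univ (fun τ _ => (hasDerivAt_two_mul_sinh_half τ).hasDerivWithinAt)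
    injective_two_mul_sinh_half.injOn (fun u => Real.exp (-(η / 2) * u ^ 2))).1
  rw [Set.image_univ, range_two_mul_sinh_half, integrableOn_univ, integrableOn_univ] at h
  refine (h (integrable_exp_neg_mul_sq (half_pos hη))).congr (Filter.Eventually.of_forall fun τ => ?_)
  simp only [smul_eq_mul, abs_of_pos (Real.cosh_pos _), ← half_mul_two_mul_sinh_half_sq]
  congr 2; ring

theorem integral_cosh_half_mul {η : ℝ} :
    ∫ τ : ℝ, Real.cosh (τ / 2) * Real.exp (-(η * (Real.cosh τ - 1))) =
      Real.sqrt (Real.pi / (η / 2)) := by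
  have h := integral_image_eq_integral_abs_deriv_smul (s := Set.univ)
    MeasurableSet.univ (fun τ _ => (hasDerivAt_two_mul_sinh_half τ).hasDerivWithinAt)
    injective_two_mul_sinh_half.injOn (fun u => Real.exp (-(η / 2) * u ^ 2))
  rw [Set.image_univ, range_two_mul_sinh_half, setIntegral_univ, setIntegral_univ,
    integral_gaussian] at h
  rw [h]
  refine integral_congr_ae (Filter.Eventually.of_forall fun τ => ?_)
  simp only [smul_eq_mul, abs_of_pos (Real.cosh_pos _), ← half_mul_two_mul_sinh_half_sq]
  congr 2; ring

theorem integrable_igDensity {η : ℝ} (hη : 0 < η) : Integrable (igDensity η) := by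
  refine ((integrable_cosh_half_mul hη).const_mul (2 * Real.sqrt η)).mono'
    (continuous_igDensity η).aestronglyMeasurable (Filter.Eventually.of_forall fun τ => ?_)
  rw [Real.norm_of_nonneg (igDensity_nonneg _ _), igDensity, Real.cosh_eq (τ / 2),
    ← mul_assoc]
  refine mul_le_mul_of_nonneg_right ?_ (Real.exp_pos _).le
  rw [show 2 * Real.sqrt η * ((Real.exp (τ / 2) + Real.exp (-(τ / 2))) / 2) =
    Real.sqrt η * (Real.exp (τ / 2) + Real.exp (-(τ / 2))) by ring, neg_div]
  refine mul_le_mul_of_nonneg_left ?_ (Real.sqrt_nonneg _)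
  linarith [Real.exp_pos (τ / 2)]

/-- This reflection symmetry is what makes the mean equal to the mass. -/
theorem exp_mul_igDensity (η τ : ℝ) : Real.exp τ * igDensity η τ = igDensity η (-τ) := by
  unfold igDensity
  rw [Real.cosh_neg, show -(-τ) / 2 = τ + -τ / 2 by ring, Real.exp_add]
  ring

theorem integrable_exp_mul_igDensity {η : ℝ} (hη : 0 < η) :
    Integrable fun τ => Real.exp τ * igDensity η τ := by
  simp only [exp_mul_igDensity]
  exact (integrable_igDensity hη).comp_neg

theorem integral_exp_mul_igDensity (η : ℝ) :
    ∫ τ, Real.exp τ * igDensity η τ = ∫ τ, igDensity η τ := by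
  simp only [exp_mul_igDensity]
  exact integral_neg_eq_self _ _

/-- The integrals with and without the factor $e^\tau$ agree, and their sum is a Gaussian integral
after $u=2\sinh(\tau/2)$. What matters is that the value does not depend on `η`. -/
theorem integral_igDensity {η : ℝ} (hη : 0 < η) :
    ∫ τ, igDensity η τ = Real.sqrt (2 * Real.pi) := by
  have h1 : (∫ τ, Real.exp τ * igDensity η τ) + ∫ τ, igDensity η τ =
      ∫ τ, (2 * Real.sqrt η) *
        (Real.cosh (τ / 2) * Real.exp (-(η * (Real.cosh τ - 1)))) := by
    rw [← integral_add (integrable_exp_mul_igDensity hη) (integrable_igDensity hη)]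
    refine integral_congr_ae (Filter.Eventually.of_forall fun τ => ?_)
    simp only [exp_mul_igDensity]
    unfold igDensity
    rw [Real.cosh_neg, Real.cosh_eq (τ / 2), neg_neg, neg_div]
    ring
  rw [integral_exp_mul_igDensity, integral_const_mul, integral_cosh_half_mul, mul_assoc,
    ← Real.sqrt_mul hη.le, show η * (Real.pi / (η / 2)) = 2 * Real.pi by field_simp] at h1
  linarith

theorem ConvexOn.le_chord_of_mem {g : ℝ → ℝ} {s : Set ℝ} (hg : ConvexOn ℝ s g) {a b u : ℝ}
    (ha : a ∈ s) (hb : b ∈ s) (hu : u ∈ s) (hab : a < b) (hau : a ≤ u) (hub : u ≤ b) :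
    g u ≤ g a + (g b - g a) / (b - a) * (u - a) := by
  rcases hau.eq_or_lt with rfl | hau
  · simp
  · have := hg.secant_mono ha hu hb hau.ne' hab.ne' hub
    rw [div_le_iff₀ (by linarith)] at this
    linarith

theorem ConvexOn.chord_le_of_notMem {g : ℝ → ℝ} {s : Set ℝ} (hg : ConvexOn ℝ s g) {a b u : ℝ}
    (ha : a ∈ s) (hb : b ∈ s) (hu : u ∈ s) (hab : a < b) (h : u < a ∨ b < u) :
    g a + (g b - g a) / (b - a) * (u - a) ≤ g u := by
  rcases h with h | h
  · have := hg.secant_mono ha hu hb h.ne hab.ne' (h.trans hab).le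
    rw [div_le_iff_of_neg (by linarith)] at this
    linarith
  · have := hg.secant_mono ha hb hu hab.ne' (hab.trans h).ne' h.le
    rw [le_div_iff₀ (by linarith)] at this
    linarith

theorem igDensity_eq_exp {η : ℝ} (hη : 0 < η) (τ : ℝ) :
    igDensity η τ = Real.exp (Real.log η / 2 - τ / 2 - η * (Real.cosh τ - 1)) := by
  rw [igDensity, sub_sub, sub_eq_add_neg (Real.log η / 2), Real.exp_add, neg_add, Real.exp_add,
    mul_assoc, neg_div, Real.sqrt_eq_rpow, Real.rpow_def_of_pos hη]
  congr 3; ring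

/-- The two densities cross exactly at two points `±σ`. -/
theorem exists_igDensity_crossing {η₁ η₂ : ℝ} (h₁ : 0 < η₁) (h : η₁ < η₂) :
    ∃ σ : ℝ, 0 < σ ∧ (∀ τ, |τ| ≤ σ → igDensity η₁ τ ≤ igDensity η₂ τ) ∧
      ∀ τ, σ < |τ| → igDensity η₂ τ ≤ igDensity η₁ τ := by
  have h₂ := h₁.trans h
  -- The log-ratio of the densities is $(\log\eta_2-\log\eta_1)/2-(\eta_2-\eta_1)(\cosh\tau-1)$,
  -- which vanishes when $\cosh\tau=1+\kappa$.
  set κ : ℝ := (Real.log η₂ - Real.log η₁) / 2 / (η₂ - η₁) with hκ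
  have hκ0 : 0 < κ := by
    have := Real.log_lt_log h₁ h
    exact div_pos (by linarith) (by linarith)
  have hmul : κ * (η₂ - η₁) = (Real.log η₂ - Real.log η₁) / 2 :=
    div_mul_cancel₀ _ (by linarith)
  have hc : Real.cosh (Real.arcosh (1 + κ)) = 1 + κ := Real.cosh_arcosh (by linarith)
  have hσ : 0 < Real.arcosh (1 + κ) := Real.arcosh_pos (by linarith)
  refine ⟨Real.arcosh (1 + κ), hσ, fun τ hτ => ?_, fun τ hτ => ?_⟩
  · have : Real.cosh τ ≤ 1 + κ := by
      rw [← hc, Real.cosh_le_cosh, abs_of_pos hσ]; exact hτ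
    rw [igDensity_eq_exp h₁, igDensity_eq_exp h₂, Real.exp_le_exp]
    nlinarith
  · have : 1 + κ < Real.cosh τ := by
      rw [← hc, Real.cosh_lt_cosh, abs_of_pos hσ]; exact hτ
    rw [igDensity_eq_exp h₁, igDensity_eq_exp h₂, Real.exp_le_exp]
    nlinarith

/-- A pointwise inequality is passed to extended nonnegative integrals without subtracting, since
some of these may be infinite. -/
theorem ofReal_add_le_ofReal_add_of_le {p₁ p₂ l₁ l₂ : ℝ} (h : p₂ + l₁ ≤ p₁ + l₂) :
    ENNReal.ofReal p₂ + ENNReal.ofReal (-p₁) + (ENNReal.ofReal l₁ + ENNReal.ofReal (-l₂)) ≤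
      ENNReal.ofReal p₁ + ENNReal.ofReal (-p₂) + (ENNReal.ofReal l₂ + ENNReal.ofReal (-l₁)) := by
  have hm : ∀ x : ℝ, ENNReal.ofReal x = ENNReal.ofReal (max x 0) := fun x => by
    rcases le_total x 0 with hx | hx
    · rw [max_eq_right hx, ENNReal.ofReal_of_nonpos hx, ENNReal.ofReal_zero]
    · rw [max_eq_left hx]
  have hd : ∀ x : ℝ, max x 0 - max (-x) 0 = x := max_zero_sub_max_neg_zero_eq_self
  have hn : ∀ x : ℝ, 0 ≤ max x 0 := fun x => le_max_right _ _
  rw [hm p₂, hm (-p₁), hm l₁, hm (-l₂), hm p₁, hm (-p₂), hm l₂, hm (-l₁)]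
  rw [← ENNReal.ofReal_add (hn _) (hn _), ← ENNReal.ofReal_add (hn _) (hn _),
    ← ENNReal.ofReal_add (add_nonneg (hn _) (hn _)) (add_nonneg (hn _) (hn _)),
    ← ENNReal.ofReal_add (hn _) (hn _), ← ENNReal.ofReal_add (hn _) (hn _),
    ← ENNReal.ofReal_add (add_nonneg (hn _) (hn _)) (add_nonneg (hn _) (hn _))]
  refine ENNReal.ofReal_le_ofReal ?_
  linarith [hd p₁, hd p₂, hd l₁, hd l₂]

theorem lintegral_add_eq_of_integral_eq {α : Type*} [MeasurableSpace α] {μ : Measure α}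
    {f g : α → ℝ} (hf : Integrable f μ) (hg : Integrable g μ) (h : ∫ x, f x ∂μ = ∫ x, g x ∂μ) :
    ∫⁻ x, ENNReal.ofReal (f x) ∂μ + ∫⁻ x, ENNReal.ofReal (-g x) ∂μ =
      ∫⁻ x, ENNReal.ofReal (g x) ∂μ + ∫⁻ x, ENNReal.ofReal (-f x) ∂μ := by
  rw [integral_eq_lintegral_pos_part_sub_lintegral_neg_part hf,
    integral_eq_lintegral_pos_part_sub_lintegral_neg_part hg] at h
  have f1 := hf.lintegral_lt_top.ne
  have f2 := hf.neg.lintegral_lt_top.ne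
  have g1 := hg.lintegral_lt_top.ne
  have g2 := hg.neg.lintegral_lt_top.ne
  simp only [Pi.neg_apply] at f2 g2
  rw [← ENNReal.toReal_eq_toReal_iff' (ENNReal.add_ne_top.2 ⟨f1, g2⟩)
    (ENNReal.add_ne_top.2 ⟨g1, f2⟩), ENNReal.toReal_add f1 g2, ENNReal.toReal_add g1 f2]
  linarith

/-- The inverse Gaussian laws of mean one decrease in the convex order as the parameter grows. -/
theorem lintegral_convex_igDensity_le {g : ℝ → ℝ} (hg : ConvexOn ℝ (Set.Ioi 0) g) {η₁ η₂ : ℝ}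
    (h₁ : 0 < η₁) (h : η₁ ≤ η₂) :
    ∫⁻ τ, (ENNReal.ofReal (g (Real.exp τ) * igDensity η₂ τ) +
        ENNReal.ofReal (-(g (Real.exp τ) * igDensity η₁ τ))) ≤
      ∫⁻ τ, (ENNReal.ofReal (g (Real.exp τ) * igDensity η₁ τ) +
        ENNReal.ofReal (-(g (Real.exp τ) * igDensity η₂ τ))) := by
  rcases h.eq_or_lt with rfl | h
  · rfl
  have h₂ := h₁.trans h
  obtain ⟨σ, hσ, hin, hout⟩ := exists_igDensity_crossing h₁ h
  set a := Real.exp (-σ)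
  set b := Real.exp σ
  have hab : a < b := Real.exp_lt_exp.2 (by linarith)
  set β := (g b - g a) / (b - a) with hβ
  set l : ℝ → ℝ := fun u => g a + β * (u - a) with hl
  -- Here `l` is the chord of `g` through the two crossing points. Thus $g-l$ and the difference of
  -- the densities change sign at the same places, and their product has a constant sign.
  have hkey : ∀ τ, g (Real.exp τ) * igDensity η₂ τ + l (Real.exp τ) * igDensity η₁ τ ≤
      g (Real.exp τ) * igDensity η₁ τ + l (Real.exp τ) * igDensity η₂ τ := by
    intro τ
    rcases le_or_gt |τ| σ with hτ | hτ
    · have h3 := hin τ hτ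
      have h4 := ConvexOn.le_chord_of_mem hg (Real.exp_pos (-σ)) (Real.exp_pos σ) (Real.exp_pos τ) hab
        (Real.exp_le_exp.2 (abs_le.1 hτ).1) (Real.exp_le_exp.2 (abs_le.1 hτ).2)
      change g (Real.exp τ) ≤ l (Real.exp τ) at h4
      nlinarith
    · have h3 := hout τ hτ
      have h4 := ConvexOn.chord_le_of_notMem hg (Real.exp_pos (-σ)) (Real.exp_pos σ)
        (Real.exp_pos τ) hab (by
          rcases lt_abs.1 hτ with h5 | h5
          · exact Or.inr (Real.exp_lt_exp.2 h5)
          · exact Or.inl (Real.exp_lt_exp.2 (by linarith)))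
      change l (Real.exp τ) ≤ g (Real.exp τ) at h4
      nlinarith
  -- An affine function has the same integral for every parameter, because mass and mean do not
  -- depend on it.
  have hli : ∀ η, 0 < η → Integrable (fun τ => l (Real.exp τ) * igDensity η τ) ∧
      ∫ τ, l (Real.exp τ) * igDensity η τ =
        (g a - β * a + β) * Real.sqrt (2 * Real.pi) := by
    intro η hη
    have e : (fun τ => l (Real.exp τ) * igDensity η τ) = fun τ =>
        (g a - β * a) * igDensity η τ + β * (Real.exp τ * igDensity η τ) := by
      funext τ; simp only [hl]; ring
    have i1 := (integrable_igDensity hη).const_mul (g a - β * a)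
    have i2 := (integrable_exp_mul_igDensity hη).const_mul β
    rw [e]
    refine ⟨i1.add i2, ?_⟩
    rw [integral_add i1 i2, integral_const_mul, integral_const_mul, integral_exp_mul_igDensity,
      integral_igDensity hη]
    ring
  obtain ⟨i1, e1⟩ := hli η₁ h₁
  obtain ⟨i2, e2⟩ := hli η₂ h₂
  have hle := lintegral_add_eq_of_integral_eq i1 i2 (e1.trans e2.symm)
  have hml : Measurable fun τ => l (Real.exp τ) := by simp only [hl]; fun_prop
  have hmI : ∀ η, Measurable (igDensity η) := fun η => (continuous_igDensity η).measurable
  have hfin : (∫⁻ τ, ENNReal.ofReal (l (Real.exp τ) * igDensity η₁ τ)) +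
      (∫⁻ τ, ENNReal.ofReal (-(l (Real.exp τ) * igDensity η₂ τ))) ≠ ⊤ :=
    ENNReal.add_ne_top.2 ⟨i1.lintegral_lt_top.ne, i2.neg.lintegral_lt_top.ne⟩
  -- Only the integrals of the affine part are known to be finite. They are added to both sides, in
  -- two forms equal by `hle`, so that the integrands can be compared pointwise.
  refine (ENNReal.add_le_add_iff_right hfin).1 ?_
  nth_rewrite 2 [hle]
  have m1 : ∀ η, Measurable fun τ => ENNReal.ofReal (l (Real.exp τ) * igDensity η τ) :=
    fun η => (hml.mul (hmI η)).ennreal_ofReal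
  rw [← lintegral_add_left (m1 η₁), ← lintegral_add_left (m1 η₂),
    ← lintegral_add_right, ← lintegral_add_right]
  · exact lintegral_mono fun τ => ofReal_add_le_ofReal_add_of_le (hkey τ)
  · exact (m1 η₂).add (hml.mul (hmI η₁)).neg.ennreal_ofReal
  · exact (m1 η₁).add (hml.mul (hmI η₂)).neg.ennreal_ofReal

end ConvexOrder

/-! ### Positivity for M-matrices. -/

section MMatrix

variable {n : Type*} [Fintype n] {A : Matrix n n ℝ} {x : n → ℝ}

/-- Minimum principle: let `m` be the least ratio $z_i/x_i$. Then $z-mx\ge 0$ vanishes at the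
minimizer, where the nonpositive off-diagonal entries force $A(z-mx)\le 0$. -/
theorem exists_mul_le_and_mulVec_le (hA : ∀ i k, i ≠ k → A i k ≤ 0) (hx : ∀ i, 0 < x i)
    [Nonempty n] (z : n → ℝ) :
    ∃ m : ℝ, (∀ i, m * x i ≤ z i) ∧ ∃ i, A.mulVec z i ≤ m * A.mulVec x i := by
  obtain ⟨i, hi⟩ := Finite.exists_min fun i => z i / x i
  have hle : ∀ k, z i / x i * x k ≤ z k := fun k => (le_div_iff₀ (hx k)).1 (hi k)
  refine ⟨z i / x i, hle, i, ?_⟩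
  simp only [Matrix.mulVec, dotProduct, Finset.mul_sum]
  refine Finset.sum_le_sum fun k _ => ?_
  rcases eq_or_ne i k with rfl | hik
  · have : z i / x i * x i = z i := div_mul_cancel₀ _ (hx i).ne'
    exact le_of_eq (by rw [mul_left_comm, this])
  · nlinarith [hA i k hik, hle k]

theorem nonneg_of_mulVec_nonneg (hA : ∀ i k, i ≠ k → A i k ≤ 0) (hx : ∀ i, 0 < x i)
    (hAx : ∀ i, 0 < A.mulVec x i) {z : n → ℝ} (hz : ∀ i, 0 ≤ A.mulVec z i) (i : n) : 0 ≤ z i := by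
  have : Nonempty n := ⟨i⟩
  obtain ⟨m, hm, k, hk⟩ := exists_mul_le_and_mulVec_le hA hx z
  have h0 : 0 ≤ m := nonneg_of_mul_nonneg_left ((hz k).trans hk) (hAx k)
  exact (mul_nonneg h0 (hx i).le).trans (hm i)

theorem pos_of_mulVec_pos (hA : ∀ i k, i ≠ k → A i k ≤ 0) (hx : ∀ i, 0 < x i)
    (hAx : ∀ i, 0 < A.mulVec x i) {z : n → ℝ} (hz : ∀ i, 0 < A.mulVec z i) (i : n) : 0 < z i := by
  have : Nonempty n := ⟨i⟩
  obtain ⟨m, hm, k, hk⟩ := exists_mul_le_and_mulVec_le hA hx z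
  have h0 : 0 < m := pos_of_mul_pos_left ((hz k).trans_le hk) (hAx k).le
  exact (mul_pos h0 (hx i)).trans_le (hm i)

theorem det_ne_zero_of_mulVec_pos [DecidableEq n] (hA : ∀ i k, i ≠ k → A i k ≤ 0)
    (hx : ∀ i, 0 < x i) (hAx : ∀ i, 0 < A.mulVec x i) : A.det ≠ 0 := by
  intro h0
  obtain ⟨z, hz0, hz⟩ := Matrix.exists_mulVec_eq_zero_iff.2 h0
  refine hz0 (funext fun i => le_antisymm ?_ ?_)
  · have := nonneg_of_mulVec_nonneg hA hx hAx (z := -z)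
      (fun i => by rw [Matrix.mulVec_neg, hz]; simp) i
    simpa using this
  · exact nonneg_of_mulVec_nonneg hA hx hAx (fun i => by rw [hz]; simp) i

theorem det_updateRow_eq_det_mul [DecidableEq n] (h : A.det ≠ 0) (j : n) (r : n → ℝ) :
    (A.updateRow j r).det = A.det * ∑ k, r k * A⁻¹ k j := by
  rw [← Matrix.cramer_transpose_apply, Matrix.cramer_eq_adjugate_mulVec, ← Matrix.adjugate_transpose,
    Matrix.inv_def, Ring.inverse_eq_inv', Finset.mul_sum]
  simp only [Matrix.mulVec, dotProduct, Matrix.transpose_apply, Matrix.smul_apply, smul_eq_mul]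
  refine Finset.sum_congr rfl fun k _ => ?_
  field_simp

end MMatrix

/-! ### The fibres of constant potential and their affine structure. -/

section Fiber

variable {N : ℕ} (u : Vertex N → Vertex N → ℝ) (j : Fin N)

/-- Twice the random potential at the vertex `i`, for the weights `u`. -/
noncomputable def potential (t : Fin N → ℝ) (v : Vertex N) : ℝ :=
  ∑ v' : Vertex N, u v v' * Real.exp (pinned t v' - pinned t v)

/-- The change of variables that keeps the coordinate `j` and replaces the other ones by the
potentials. -/
noncomputable def potentialMap (t : Fin N → ℝ) (i : Fin N) : ℝ :=
  if i = j then t j else potential u t (some i)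

/-- The Schrödinger matrix of a potential, with the row `j` replaced by that of the identity. -/
def fiberMatrix (y : Fin N → ℝ) : Matrix (Fin N) (Fin N) ℝ :=
  Matrix.of fun i k => if i = j then (if i = k then 1 else 0)
    else (if i = k then y i else 0) - u (some i) (some k)

/-- The slope of the field, as an affine function of its value at `j`. -/
noncomputable def fiberSlope (y : Fin N → ℝ) : Fin N → ℝ :=
  (fiberMatrix u j y)⁻¹.mulVec (Pi.single j 1)

/-- The intercept of the field, as an affine function of its value at `j`. -/
noncomputable def fiberIntercept (y : Fin N → ℝ) : Fin N → ℝ :=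
  (fiberMatrix u j y)⁻¹.mulVec (Function.update (fun i => u (some i) none) j 0)

/-- The effective weight between `j` and the root, apart from the edge between them. -/
noncomputable def fiberWeight (y : Fin N → ℝ) : ℝ :=
  ∑ k, u (some j) (some k) * fiberIntercept u j y k

/-- Weights that are symmetric and nonnegative, vanish on the diagonal and on the edge from `j` to
the root, and are positive on the other edges from the root. -/
structure IsFiberWeight : Prop where
  symm : ∀ v v', u v v' = u v' v
  diag : ∀ v, u v v = 0
  nonneg : ∀ v v', 0 ≤ u v v'
  pos : ∀ i, i ≠ j → 0 < u (some i) none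
  zero : u (some j) none = 0

variable {u j}

theorem fiberMatrix_offDiag (hu : IsFiberWeight u j) (y : Fin N → ℝ) (i k : Fin N) (hik : i ≠ k) :
    fiberMatrix u j y i k ≤ 0 := by
  have := hu.nonneg (some i) (some k)
  by_cases hj : i = j
  · subst hj; simp [fiberMatrix, hik]
  · simp [fiberMatrix, hj, hik, this]

theorem fiberMatrix_mulVec (y z : Fin N → ℝ) (i : Fin N) :
    (fiberMatrix u j y).mulVec z i =
      if i = j then z j else y i * z i - ∑ k, u (some i) (some k) * z k := by
  simp only [Matrix.mulVec, dotProduct, fiberMatrix, Matrix.of_apply]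
  split_ifs with h
  · subst h; simp
  · simp [sub_mul, Finset.sum_sub_distrib]

theorem fiberMatrix_update (y : Fin N → ℝ) (τ : ℝ) :
    fiberMatrix u j (Function.update y j τ) = fiberMatrix u j y := by
  ext i k
  by_cases h : i = j
  · simp [fiberMatrix, h]
  · simp [fiberMatrix, h]

theorem potential_some (t : Fin N → ℝ) (i : Fin N) :
    potential u t (some i) = (u (some i) none + ∑ k, u (some i) (some k) * Real.exp (t k)) /
      Real.exp (t i) := by
  simp only [potential, Fintype.sum_option, pinned, Option.elim, Real.exp_sub, Real.exp_zero,
    add_div, Finset.sum_div]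
  congr 1
  · ring
  · exact Finset.sum_congr rfl fun k _ => by ring

theorem potential_none (t : Fin N → ℝ) (h : u none none = 0) :
    potential u t none = ∑ k, u none (some k) * Real.exp (t k) := by
  simp [potential, Fintype.sum_option, pinned, h]

/-- Multiplying the definition of each potential by $e^{t_i}$ gives a linear system for $e^t$,
completed by row $j$, which prescribes $e^{t_j}$. Since $e^t$ and its image are positive, the
M-matrix lemmas apply. -/
theorem fiberMatrix_mulVec_exp (hu : IsFiberWeight u j) (t : Fin N → ℝ) :
    (fiberMatrix u j (potentialMap u j t)).mulVec (fun k => Real.exp (t k)) =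
      Function.update (fun i => u (some i) none) j (Real.exp (t j)) := by
  ext i
  rw [fiberMatrix_mulVec]
  by_cases h : i = j
  · subst h; simp
  · simp only [h, if_false, potentialMap, potential_some, Function.update_of_ne (Ne.intro h)]
    rw [div_mul_cancel₀ _ (Real.exp_pos _).ne']
    ring

theorem update_pos (hu : IsFiberWeight u j) {s : ℝ} (hs : 0 < s) (i : Fin N) :
    0 < Function.update (fun i => u (some i) none) j s i := by
  by_cases h : i = j
  · subst h; simpa
  · simpa [h] using hu.pos i h

theorem det_fiberMatrix_ne_zero (hu : IsFiberWeight u j) (t : Fin N → ℝ) :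
    (fiberMatrix u j (potentialMap u j t)).det ≠ 0 :=
  det_ne_zero_of_mulVec_pos (fiberMatrix_offDiag hu _) (fun k => Real.exp_pos (t k))
    fun i => by
      rw [fiberMatrix_mulVec_exp hu]
      exact update_pos hu (Real.exp_pos _) i

theorem injective_potentialMap (hu : IsFiberWeight u j) :
    Function.Injective (potentialMap u j) := by
  intro t t' h
  have h1 := fiberMatrix_mulVec_exp hu t
  have h2 := fiberMatrix_mulVec_exp hu t'
  have hj : t j = t' j := by simpa [potentialMap] using congrFun h j
  rw [h, hj, ← h2] at h1
  have h3 := Matrix.mulVec_injective_of_isUnit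
    ((Matrix.isUnit_iff_isUnit_det _).2 (det_fiberMatrix_ne_zero hu t').isUnit) h1
  exact funext fun k => Real.exp_injective (congrFun h3 k)

theorem fiberMatrix_mulVec_slope (hu : IsFiberWeight u j) (t : Fin N → ℝ) :
    (fiberMatrix u j (potentialMap u j t)).mulVec (fiberSlope u j (potentialMap u j t)) =
      Pi.single j 1 := by
  rw [fiberSlope, Matrix.mulVec_mulVec, Matrix.mul_nonsing_inv _
    (det_fiberMatrix_ne_zero hu t).isUnit, Matrix.one_mulVec]

theorem fiberMatrix_mulVec_intercept (hu : IsFiberWeight u j) (t : Fin N → ℝ) :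
    (fiberMatrix u j (potentialMap u j t)).mulVec (fiberIntercept u j (potentialMap u j t)) =
      Function.update (fun i => u (some i) none) j 0 := by
  rw [fiberIntercept, Matrix.mulVec_mulVec, Matrix.mul_nonsing_inv _
    (det_fiberMatrix_ne_zero hu t).isUnit, Matrix.one_mulVec]

theorem fiberMatrix_mulVec_affine (hu : IsFiberWeight u j) (t : Fin N → ℝ) (s : ℝ) :
    (fiberMatrix u j (potentialMap u j t)).mulVec
      (fun k => fiberIntercept u j (potentialMap u j t) k +
        s * fiberSlope u j (potentialMap u j t) k) =
      Function.update (fun i => u (some i) none) j s := by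
  change (fiberMatrix u j (potentialMap u j t)).mulVec
      (fiberIntercept u j (potentialMap u j t) + s • fiberSlope u j (potentialMap u j t)) = _
  rw [Matrix.mulVec_add, Matrix.mulVec_smul, fiberMatrix_mulVec_slope hu,
    fiberMatrix_mulVec_intercept hu]
  ext i
  by_cases h : i = j
  · subst h; simp
  · simp [h]

theorem fiberIntercept_nonneg (hu : IsFiberWeight u j) (t : Fin N → ℝ) (k : Fin N) :
    0 ≤ fiberIntercept u j (potentialMap u j t) k := by
  refine nonneg_of_mulVec_nonneg (fiberMatrix_offDiag hu (potentialMap u j t))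
    (fun k => Real.exp_pos (t k)) (fun i => ?_) (fun i => ?_) k
  · rw [fiberMatrix_mulVec_exp hu]
    exact update_pos hu (Real.exp_pos _) i
  · rw [fiberMatrix_mulVec_intercept hu]
    by_cases h : i = j
    · subst h; simp
    · simpa [h] using hu.nonneg (some i) none

theorem fiberWeight_nonneg (hu : IsFiberWeight u j) (t : Fin N → ℝ) :
    0 ≤ fiberWeight u j (potentialMap u j t) :=
  Finset.sum_nonneg fun k _ => mul_nonneg (hu.nonneg _ _) (fiberIntercept_nonneg hu t k)

theorem fiber_affine_pos (hu : IsFiberWeight u j) (t : Fin N → ℝ) {s : ℝ} (hs : 0 < s)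
    (k : Fin N) :
    0 < fiberIntercept u j (potentialMap u j t) k + s * fiberSlope u j (potentialMap u j t) k := by
  refine pos_of_mulVec_pos (fiberMatrix_offDiag hu (potentialMap u j t))
    (fun k => Real.exp_pos (t k)) (fun i => ?_) (z := fun k => fiberIntercept u j (potentialMap u j t) k +
        s * fiberSlope u j (potentialMap u j t) k) (fun i => ?_) k
  · rw [fiberMatrix_mulVec_exp hu]
    exact update_pos hu (Real.exp_pos _) i
  · rw [fiberMatrix_mulVec_affine hu]
    exact update_pos hu hs i

/-- Along a fibre, the exponential of the field is an affine function of its value at `j`. -/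
theorem exp_eq_affine (hu : IsFiberWeight u j) (t : Fin N → ℝ) (k : Fin N) :
    Real.exp (t k) = fiberIntercept u j (potentialMap u j t) k +
      Real.exp (t j) * fiberSlope u j (potentialMap u j t) k := by
  have h := (fiberMatrix_mulVec_exp hu t).trans (fiberMatrix_mulVec_affine hu t (Real.exp (t j))).symm
  exact congrFun (Matrix.mulVec_injective_of_isUnit
    ((Matrix.isUnit_iff_isUnit_det _).2 (det_fiberMatrix_ne_zero hu t).isUnit) h) k

/-- Each fibre is a complete line: the affine solution with value $e^\tau$ at `j` is positive, and
its logarithm is a field with the same potentials. -/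
theorem update_mem_range_potentialMap (hu : IsFiberWeight u j) (t : Fin N → ℝ) (τ : ℝ) :
    Function.update (potentialMap u j t) j τ ∈ Set.range (potentialMap u j) := by
  set y := potentialMap u j t with hy
  set z : Fin N → ℝ := fun k => fiberIntercept u j y k + Real.exp τ * fiberSlope u j y k with hz
  have hpos : ∀ k, 0 < z k := fiber_affine_pos hu t (Real.exp_pos τ)
  have hA : (fiberMatrix u j y).mulVec z = _ := fiberMatrix_mulVec_affine hu t (Real.exp τ)
  have hexp : ∀ k, Real.exp (Real.log (z k)) = z k := fun k => Real.exp_log (hpos k)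
  refine ⟨fun k => Real.log (z k), funext fun i => ?_⟩
  have hi := congrFun hA i
  rw [fiberMatrix_mulVec] at hi
  by_cases h : i = j
  · subst h
    simp only [if_true, Function.update_self] at hi
    simp [potentialMap, hi]
  · simp only [h, if_false, Function.update_of_ne (Ne.intro h)] at hi
    simp only [potentialMap, h, if_false, potential_some, hexp, Function.update_of_ne (Ne.intro h)]
    rw [← hi, div_eq_iff (hpos i).ne']
    ring

theorem fiberSlope_self (hu : IsFiberWeight u j) (t : Fin N → ℝ) :
    fiberSlope u j (potentialMap u j t) j = 1 := by
  have := congrFun (fiberMatrix_mulVec_slope hu t) j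
  rw [fiberMatrix_mulVec] at this
  simpa using this

theorem fiberIntercept_self (hu : IsFiberWeight u j) (t : Fin N → ℝ) :
    fiberIntercept u j (potentialMap u j t) j = 0 := by
  have := congrFun (fiberMatrix_mulVec_intercept hu t) j
  rw [fiberMatrix_mulVec] at this
  simpa using this

/-- Reciprocity: the effective weight seen from the root is the one seen from `j`. -/
theorem sum_mul_fiberSlope (hu : IsFiberWeight u j) (t : Fin N → ℝ) :
    ∑ k, u none (some k) * fiberSlope u j (potentialMap u j t) k =
      fiberWeight u j (potentialMap u j t) := by
  have ha := fiberMatrix_mulVec_slope hu t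
  have hb := fiberMatrix_mulVec_intercept hu t
  have ha1 := fiberSlope_self hu t
  have hb0 := fiberIntercept_self hu t
  set y := potentialMap u j t
  rw [fiberWeight]
  set a := fiberSlope u j y
  set b := fiberIntercept u j y
  -- Discrete Green identity: pair the equation of the slope with the intercept and conversely, then
  -- compare using the symmetry of `u`.
  have ea : ∀ i, b i * (y i * a i - ∑ k, u (some i) (some k) * a k) =
      if i = j then -∑ k, u (some j) (some k) * a k * b i else 0 := by
    intro i
    have := congrFun ha i
    rw [fiberMatrix_mulVec] at this
    by_cases h : i = j
    · subst h; simp [hb0]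
    · simp only [h, if_false, Pi.single_eq_of_ne (Ne.intro h)] at this
      simp [h, this]
  have eb : ∀ i, a i * (y i * b i - ∑ k, u (some i) (some k) * b k) =
      u none (some i) * a i + if i = j then (-∑ k, u (some j) (some k) * b k) else 0 := by
    intro i
    have := congrFun hb i
    rw [fiberMatrix_mulVec] at this
    by_cases h : i = j
    · subst h; simp [hb0, ha1, hu.symm none (some i), hu.zero]
    · simp only [h, if_false, Function.update_of_ne (Ne.intro h)] at this
      rw [this, if_neg h, hu.symm none (some i), add_zero, mul_comm]
  have sa := Finset.sum_congr (rfl : (Finset.univ : Finset (Fin N)) = _) fun i _ => ea i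
  have sb := Finset.sum_congr (rfl : (Finset.univ : Finset (Fin N)) = _) fun i _ => eb i
  simp only [Finset.sum_add_distrib, Finset.sum_ite_eq', Finset.mem_univ, if_true, hb0, mul_zero,
    Finset.sum_const_zero, neg_zero, mul_sub, Finset.sum_sub_distrib, Finset.mul_sum] at sa sb
  have hsw : ∑ i, ∑ k, b i * (u (some i) (some k) * a k) =
      ∑ i, ∑ k, a i * (u (some i) (some k) * b k) := by
    rw [Finset.sum_comm]
    refine Finset.sum_congr rfl fun i _ => Finset.sum_congr rfl fun k _ => ?_
    rw [hu.symm]; ring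
  have hd : ∑ i, b i * (y i * a i) = ∑ i, a i * (y i * b i) :=
    Finset.sum_congr rfl fun i _ => by ring
  linarith

end Fiber

/-! ### The density and the Jacobian in the fibre coordinates. -/

section Density

variable {N : ℕ}

/-- The weights as a function of two vertices, vanishing on the diagonal. -/
def wt (W : Weight N) (v v' : Vertex N) : ℝ := if v = v' then 0 else W s(v, v')

theorem wt_comm (W : Weight N) (v v' : Vertex N) : wt W v v' = wt W v' v := by
  simp only [wt, eq_comm (a := v), Sym2.eq_swap (a := v)]

theorem wt_self (W : Weight N) (v : Vertex N) : wt W v v = 0 := if_pos rfl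

/-- The varied edge gets weight zero here, so that the coordinates and all fibre quantities are
independent of its actual weight. -/
theorem isFiberWeight_wt {W : Weight N} (hW : ∀ i j, i ≠ j → 0 < W s(i, j)) (j : Fin N) :
    IsFiberWeight (wt (Function.update W s(none, some j) 0)) j where
  symm := wt_comm _
  diag := wt_self _
  nonneg v v' := by
    unfold wt
    split_ifs with h
    · exact le_rfl
    · rw [Function.update_apply]
      split_ifs
      · exact le_rfl
      · exact (hW v v' h).le
  pos i hi := by
    have h1 : s((some i : Vertex N), none) ≠ s(none, some j) := by
      simp [hi]
    rw [wt, if_neg (by simp), Function.update_of_ne h1]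
    exact hW _ _ (by simp)
  zero := by
    rw [wt, if_neg (by simp), Sym2.eq_swap, Function.update_self]

theorem wt_update_of_ne {W : Weight N} {e : Sym2 (Vertex N)} {v v' : Vertex N} (h : s(v, v') ≠ e)
    (w w' : ℝ) : wt (Function.update W e w) v v' = wt (Function.update W e w') v v' := by
  simp only [wt, Function.update_of_ne h]

theorem wt_update_some_none (W : Weight N) (j : Fin N) (w : ℝ) :
    wt (Function.update W s(none, some j) w) (some j) none = w := by
  rw [wt, if_neg (by simp), Sym2.eq_swap, Function.update_self]

/-- The interaction energy. -/
noncomputable def energy (u : Vertex N → Vertex N → ℝ) (t : Fin N → ℝ) : ℝ :=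
  1 / 2 * ∑ v : Vertex N, ∑ v' : Vertex N, u v v' * (Real.cosh (pinned t v - pinned t v') - 1)

theorem effAction_eq (W : Weight N) (t : Fin N → ℝ) :
    effAction W t = energy (wt W) t - 1 / 2 * (Real.log (treePoly W t) - 2 * ∑ k, t k) := by
  unfold effAction energy
  congr 2
  refine Finset.sum_congr rfl fun v _ => Finset.sum_congr rfl fun v' _ => ?_
  unfold wt
  split_ifs with h
  · subst h; simp
  · rfl

theorem energy_eq_sum_potential {u : Vertex N → Vertex N → ℝ} (hs : ∀ v v', u v v' = u v' v)
    (t : Fin N → ℝ) :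
    energy u t = 1 / 2 * ∑ v, potential u t v - 1 / 2 * ∑ v, ∑ v', u v v' := by
  have h : ∑ v, potential u t v =
      ∑ v : Vertex N, ∑ v' : Vertex N, u v v' * Real.exp (-(pinned t v' - pinned t v)) := by
    unfold potential
    rw [Finset.sum_comm]
    refine Finset.sum_congr rfl fun v _ => Finset.sum_congr rfl fun v' _ => ?_
    rw [hs, neg_sub]
  have h2 : 2 * ∑ v, potential u t v = ∑ v : Vertex N, ∑ v' : Vertex N,
      2 * (u v v' * Real.cosh (pinned t v - pinned t v')) := by
    rw [two_mul]
    nth_rewrite 1 [h]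
    unfold potential
    rw [← Finset.sum_add_distrib]
    refine Finset.sum_congr rfl fun v _ => ?_
    rw [← Finset.sum_add_distrib]
    refine Finset.sum_congr rfl fun v' _ => ?_
    rw [Real.cosh_eq, neg_sub, neg_sub]
    ring
  simp only [← Finset.mul_sum] at h2
  simp only [energy, mul_sub, mul_one, Finset.sum_sub_distrib]
  linarith

/-- The part of the energy that is constant along a fibre. -/
noncomputable def fiberEnergy (u : Vertex N → Vertex N → ℝ) (j : Fin N) (y : Fin N → ℝ) : ℝ :=
  1 / 2 * (∑ i, if i = j then 0 else y i) +
    1 / 2 * (∑ k, u (some j) (some k) * fiberSlope u j y k +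
      ∑ k, u none (some k) * fiberIntercept u j y k) +
    fiberWeight u j y - 1 / 2 * ∑ v, ∑ v', u v v'

variable {u : Vertex N → Vertex N → ℝ} {j : Fin N}

theorem potential_some_self (hu : IsFiberWeight u j) (t : Fin N → ℝ) :
    potential u t (some j) = fiberWeight u j (potentialMap u j t) * Real.exp (-t j) +
      ∑ k, u (some j) (some k) * fiberSlope u j (potentialMap u j t) k := by
  have h : ∑ k, u (some j) (some k) * Real.exp (t k) = fiberWeight u j (potentialMap u j t) +
      Real.exp (t j) * ∑ k, u (some j) (some k) * fiberSlope u j (potentialMap u j t) k := by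
    rw [fiberWeight, Finset.mul_sum, ← Finset.sum_add_distrib]
    refine Finset.sum_congr rfl fun k _ => ?_
    rw [exp_eq_affine hu t k]
    ring
  rw [potential_some, hu.zero, h, zero_add, add_div, mul_div_cancel_left₀ _ (Real.exp_pos _).ne',
    Real.exp_neg]
  ring

theorem potential_none_eq (hu : IsFiberWeight u j) (t : Fin N → ℝ) :
    potential u t none = fiberWeight u j (potentialMap u j t) * Real.exp (t j) +
      ∑ k, u none (some k) * fiberIntercept u j (potentialMap u j t) k := by
  rw [potential_none t (hu.diag none), ← sum_mul_fiberSlope hu, Finset.sum_mul,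
    ← Finset.sum_add_distrib]
  refine Finset.sum_congr rfl fun k _ => ?_
  rw [exp_eq_affine hu t k]
  ring

/-- The energy is half the sum of the potentials, up to a constant. Those away from `j` and the root
are coordinates. The other two contribute $ce^{-t_j}$ and $ce^{t_j}$ with the same $c$ by
reciprocity, hence the cosh. -/
theorem energy_eq_fiberEnergy (hu : IsFiberWeight u j) (t : Fin N → ℝ) :
    energy u t = fiberWeight u j (potentialMap u j t) * (Real.cosh (t j) - 1) +
      fiberEnergy u j (potentialMap u j t) := by
  have h : ∑ i, potential u t (some i) = (∑ i, if i = j then 0 else potentialMap u j t i) +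
      potential u t (some j) := by
    have : ∀ i, potential u t (some i) = (if i = j then 0 else potentialMap u j t i) +
        if i = j then potential u t (some j) else 0 := by
      intro i
      by_cases hi : i = j
      · subst hi; simp
      · simp [hi, potentialMap]
    rw [Finset.sum_congr rfl fun i _ => this i, Finset.sum_add_distrib]
    simp
  rw [energy_eq_sum_potential hu.symm, Fintype.sum_option, h, potential_some_self hu,
    potential_none_eq hu, fiberEnergy, Real.cosh_eq]
  ring

theorem energy_update (W : Weight N) (j : Fin N) (w : ℝ) (t : Fin N → ℝ) :
    energy (wt (Function.update W s(none, some j) w)) t =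
      energy (wt (Function.update W s(none, some j) 0)) t + w * (Real.cosh (t j) - 1) := by
  have h : ∀ v v' : Vertex N, wt (Function.update W s(none, some j) w) v v' =
      wt (Function.update W s(none, some j) 0) v v' +
        ((if v = none then if v' = some j then w else 0 else 0) +
          (if v = some j then if v' = none then w else 0 else 0)) := by
    intro v v'
    by_cases hv : s(v, v') = s(none, some j)
    · rcases Sym2.eq_iff.1 hv with ⟨rfl, rfl⟩ | ⟨rfl, rfl⟩
      · simp [wt]
      · simp [wt, Sym2.eq_swap]
    · rw [wt_update_of_ne hv w 0]
      rw [Sym2.eq_iff] at hv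
      push Not at hv
      split_ifs <;> simp_all
  simp only [energy, h, add_mul, Finset.sum_add_distrib, ite_mul, zero_mul, Finset.sum_ite_eq',
    Finset.mem_univ, if_true, Finset.sum_ite_irrel, Finset.sum_const_zero]
  simp only [pinned, Option.elim, sub_zero, zero_sub, Real.cosh_neg]
  ring

theorem reducedLaplacian_edgeFactor (W : Weight N) (t : Fin N → ℝ) :
    reducedLaplacian (edgeFactor W t) = Matrix.diagonal (fun i => Real.exp (t i)) *
      (Matrix.of fun i k => (if i = k then potential (wt W) t (some i) else 0) -
        wt W (some i) (some k)) * Matrix.diagonal (fun i => Real.exp (t i)) := by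
  ext i k
  rw [Matrix.mul_diagonal, Matrix.diagonal_mul]
  simp only [reducedLaplacian, Matrix.of_apply, edgeFactor, Sym2.lift_mk]
  by_cases h : i = k
  · subst h
    simp only [if_true, wt_self, sub_zero, potential, Finset.mul_sum, Finset.sum_mul]
    rw [sub_eq_iff_eq_add]
    rw [← Finset.sum_erase_add _ _ (Finset.mem_univ (some i)),
      ← Finset.sum_erase_add (a := some i) _ (fun v => Real.exp (t i) * _ * _)
        (Finset.mem_univ (some i))]
    simp only [wt_self, zero_mul, mul_zero, add_zero]
    congr 1
    refine Finset.sum_congr rfl fun v hv => ?_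
    rw [wt, if_neg (Finset.ne_of_mem_erase hv).symm]
    have hp : pinned t (some i) = t i := rfl
    rw [hp, show t i + pinned t v = t i + (pinned t v - t i) + t i by ring,
      Real.exp_add, Real.exp_add]
    ring
  · simp only [h, if_false, zero_sub, wt, Option.some.injEq, pinned, Option.elim, Real.exp_add]
    ring

/-- After the factors $e^{t_i}$ are extracted, the reduced Laplacian differs from the fibre matrix
only in row $j$. Cramer's rule pairs this row with the slope, which is column $j$ of the inverse,
and yields $e^{-t_j}(w+c)$. -/
theorem treePoly_update {W : Weight N} (hu : IsFiberWeight (wt (Function.update W s(none, some j) 0)) j)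
    (w : ℝ) (t : Fin N → ℝ) :
    treePoly (Function.update W s(none, some j) w) t = Real.exp (∑ k, t k) ^ 2 *
      ((fiberMatrix (wt (Function.update W s(none, some j) 0)) j
        (potentialMap (wt (Function.update W s(none, some j) 0)) j t)).det *
        (Real.exp (-t j) * (w + fiberWeight (wt (Function.update W s(none, some j) 0)) j
          (potentialMap (wt (Function.update W s(none, some j) 0)) j t)))) := by
  set u := wt (Function.update W s(none, some j) 0) with hu0
  set u' := wt (Function.update W s(none, some j) w) with hu'
  have hss : ∀ i k : Fin N, u' (some i) (some k) = u (some i) (some k) := fun i k =>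
    wt_update_of_ne (by simp) _ _
  have hsn : ∀ i : Fin N, i ≠ j → u' (some i) none = u (some i) none := fun i hi =>
    wt_update_of_ne (by simp [hi]) _ _
  have hrow : (Matrix.of fun i k => (if i = k then potential u' t (some i) else 0) -
      u' (some i) (some k)) = (fiberMatrix u j (potentialMap u j t)).updateRow j
        (fun k => (if j = k then potential u' t (some j) else 0) - u (some j) (some k)) := by
    ext i k
    by_cases hi : i = j
    · subst hi
      rw [Matrix.updateRow_self, Matrix.of_apply, hss]
    · rw [Matrix.updateRow_ne hi]
      simp only [Matrix.of_apply, fiberMatrix, if_neg hi, potentialMap, hss, potential_some,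
        hsn i hi]
  have hpot : potential u' t (some j) = w * Real.exp (-t j) + potential u t (some j) := by
    rw [potential_some, potential_some, hu.zero, hu', wt_update_some_none]
    simp only [← hu', hss]
    rw [Real.exp_neg]
    ring
  rw [treePoly_eq_det, reducedLaplacian_edgeFactor, Matrix.det_mul, Matrix.det_mul,
    Matrix.det_diagonal, ← Real.exp_sum, hrow, det_updateRow_eq_det_mul (det_fiberMatrix_ne_zero hu t)]
  have hs : ∀ k, (fiberMatrix u j (potentialMap u j t))⁻¹ k j =
      fiberSlope u j (potentialMap u j t) k := fun k => by
    rw [fiberSlope, Matrix.mulVec_single_one]; rfl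
  simp only [hs, sub_mul, Finset.sum_sub_distrib, ite_mul, zero_mul, Finset.sum_ite_eq,
    Finset.mem_univ, if_true, fiberSlope_self hu, mul_one, hpot]
  rw [potential_some_self hu]
  ring

/-- Along a fibre, the density of the field is the inverse Gaussian one. -/
theorem exp_neg_effAction {W : Weight N}
    (hu : IsFiberWeight (wt (Function.update W s(none, some j) 0)) j) {w : ℝ} (hw : 0 < w)
    (t : Fin N → ℝ) {y : Fin N → ℝ}
    (hy : y = potentialMap (wt (Function.update W s(none, some j) 0)) j t) :
    Real.exp (-effAction (Function.update W s(none, some j) w) t) =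
      Real.sqrt |(fiberMatrix (wt (Function.update W s(none, some j) 0)) j y).det| *
        Real.exp (-fiberEnergy (wt (Function.update W s(none, some j) 0)) j y) *
        igDensity (w + fiberWeight (wt (Function.update W s(none, some j) 0)) j y) (t j) := by
  subst hy
  have hdet := det_fiberMatrix_ne_zero hu t
  have hc := fiberWeight_nonneg hu t
  have hw' : 0 < w + fiberWeight (wt (Function.update W s(none, some j) 0)) j
    (potentialMap (wt (Function.update W s(none, some j) 0)) j t) := by linarith
  -- The term $\sum_k t_k$ cancels against the square root of the tree polynomial. What remains of
  -- that root besides the determinant, $e^{-t_j/2}\sqrt{w+c}$, is the prefactor of the inverse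
  -- Gaussian density.
  rw [effAction_eq, energy_update, energy_eq_fiberEnergy hu, treePoly_update hu, igDensity_eq_exp hw',
    Real.log_mul (by positivity) (by positivity), Real.log_pow, Real.log_exp,
    Real.log_mul hdet (by positivity), Real.log_mul (Real.exp_pos _).ne' hw'.ne', Real.log_exp,
    Real.sqrt_eq_rpow, Real.rpow_def_of_pos (abs_pos.2 hdet), Real.log_abs, ← Real.exp_add,
    ← Real.exp_add]
  congr 1
  push_cast
  ring

/-- The derivative of `potentialMap`. -/
noncomputable def potentialDeriv (u : Vertex N → Vertex N → ℝ) (j : Fin N) (t : Fin N → ℝ) :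
    Matrix (Fin N) (Fin N) ℝ :=
  Matrix.diagonal (fun i => (if i = j then 1 else -1) * Real.exp (-t i)) *
    fiberMatrix u j (potentialMap u j t) * Matrix.diagonal fun k => Real.exp (t k)

/-- The exponential factors cancel, so the Jacobian depends only on the fibre. -/
theorem abs_det_potentialDeriv (u : Vertex N → Vertex N → ℝ) (j : Fin N) (t : Fin N → ℝ) :
    |(potentialDeriv u j t).det| = |(fiberMatrix u j (potentialMap u j t)).det| := by
  rw [potentialDeriv, Matrix.det_mul, Matrix.det_mul, Matrix.det_diagonal, Matrix.det_diagonal,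
    Finset.prod_mul_distrib, abs_mul, abs_mul, abs_mul, Finset.abs_prod, Finset.abs_prod,
    Finset.abs_prod]
  have : ∀ i : Fin N, |(if i = j then (1 : ℝ) else -1)| = 1 := fun i => by split_ifs <;> simp
  simp only [this, Finset.prod_const_one, one_mul, Real.abs_exp, ← Real.exp_sum,
    Finset.sum_neg_distrib]
  rw [mul_right_comm, ← Real.exp_add]
  simp

theorem hasFDerivAt_pinned (v : Vertex N) (t : Fin N → ℝ) :
    HasFDerivAt (fun t : Fin N → ℝ => pinned t v)
      (v.elim 0 fun k => ContinuousLinearMap.proj (R := ℝ) (φ := fun _ : Fin N => ℝ) k) t := by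
  rcases v with _ | k
  · exact hasFDerivAt_const 0 t
  · exact hasFDerivAt_apply k t

/-- For $i\ne j$, $\partial y_i/\partial t_k=u_{ik}e^{t_k-t_i}-\delta_{ik}y_i$, which is
$-e^{-t_i}(\delta_{ik}y_i-u_{ik})e^{t_k}$. -/
theorem hasFDerivAt_potentialMap (hu : IsFiberWeight u j) (t : Fin N → ℝ) :
    HasFDerivAt (potentialMap u j) (LinearMap.toContinuousLinearMap
      (Matrix.toLin' (potentialDeriv u j t))) t := by
  rw [hasFDerivAt_pi']
  intro i
  by_cases hi : i = j
  · subst hi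
    have h : (fun t => potentialMap u i t i) = fun t : Fin N → ℝ => t i := by
      funext t; simp [potentialMap]
    rw [h]
    refine (hasFDerivAt_apply (𝕜 := ℝ) (F' := fun _ : Fin N => ℝ) i t).congr_fderiv ?_
    ext x
    simp only [ContinuousLinearMap.comp_apply, ContinuousLinearMap.proj_apply,
      LinearMap.coe_toContinuousLinearMap', Matrix.toLin'_apply, potentialDeriv,
      ← Matrix.mulVec_mulVec, Matrix.mulVec_diagonal, fiberMatrix_mulVec]
    rw [if_pos trivial, if_pos trivial, one_mul, ← mul_assoc, ← Real.exp_add]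
    simp
  · have h : (fun t => potentialMap u j t i) = fun t : Fin N → ℝ =>
        ∑ v : Vertex N, u (some i) v * Real.exp (pinned t v - pinned t (some i)) := by
      funext t; simp [potentialMap, hi, potential]
    rw [h]
    have hd := HasFDerivAt.fun_sum (u := Finset.univ) fun (v : Vertex N) _ =>
      (((hasFDerivAt_pinned v t).sub (hasFDerivAt_pinned (some i) t)).exp.const_mul (u (some i) v))
    refine hd.congr_fderiv ?_
    ext x
    simp only [ContinuousLinearMap.comp_apply, ContinuousLinearMap.proj_apply,
      LinearMap.coe_toContinuousLinearMap', Matrix.toLin'_apply, potentialDeriv,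
      ← Matrix.mulVec_mulVec, Matrix.mulVec_diagonal, fiberMatrix_mulVec, hi, if_false,
      _root_.sum_apply, _root_.add_apply, _root_.smul_apply, _root_.sub_apply, _root_.zero_apply,
      Pi.sub_apply, smul_eq_mul, potentialMap, potential, Fintype.sum_option, Option.elim, pinned]
    have hexp : Real.exp (-t i) * Real.exp (t i) = 1 := by rw [← Real.exp_add]; simp
    simp only [sub_eq_add_neg, Real.exp_add, Real.exp_zero, mul_add, Finset.sum_add_distrib,
      Finset.mul_sum, Finset.sum_mul, add_mul, ← Finset.sum_neg_distrib]
    have h1 : ∀ k, -1 * Real.exp (-t i) * (u (some i) (some k) *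
        (Real.exp (t k) * Real.exp (-t i)) * (Real.exp (t i) * x i)) =
        u (some i) (some k) * (Real.exp (t k) * Real.exp (-t i) * -x i) := fun k => by
      linear_combination (-(u (some i) (some k) * Real.exp (t k) * Real.exp (-t i) * x i)) * hexp
    have h2 : -1 * Real.exp (-t i) * (u (some i) none * (1 * Real.exp (-t i)) *
        (Real.exp (t i) * x i)) = u (some i) none * (1 * Real.exp (-t i) * -x i) := by
      linear_combination (-(u (some i) none * Real.exp (-t i) * x i)) * hexp
    have h3 : ∀ k, -1 * Real.exp (-t i) * -(u (some i) (some k) * (Real.exp (t k) * x k)) =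
        u (some i) (some k) * (Real.exp (t k) * Real.exp (-t i) * x k) := fun k => by ring
    simp only [h1, h2, h3]
    ring

end Density

/-! ### Comparison of integrals fibre by fibre, for edges at the root. -/

section FiberIntegral

variable {N : ℕ} {u : Vertex N → Vertex N → ℝ} {j : Fin N}

theorem continuous_potentialMap (hu : IsFiberWeight u j) : Continuous (potentialMap u j) :=
  continuous_iff_continuousAt.2 fun t => (hasFDerivAt_potentialMap hu t).continuousAt

theorem fiberSlope_update (y : Fin N → ℝ) (τ : ℝ) :
    fiberSlope u j (Function.update y j τ) = fiberSlope u j y := by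
  rw [fiberSlope, fiberSlope, fiberMatrix_update]

theorem fiberIntercept_update (y : Fin N → ℝ) (τ : ℝ) :
    fiberIntercept u j (Function.update y j τ) = fiberIntercept u j y := by
  rw [fiberIntercept, fiberIntercept, fiberMatrix_update]

theorem fiberWeight_update (y : Fin N → ℝ) (τ : ℝ) :
    fiberWeight u j (Function.update y j τ) = fiberWeight u j y := by
  rw [fiberWeight, fiberWeight, fiberIntercept_update]

theorem fiberEnergy_update (y : Fin N → ℝ) (τ : ℝ) :
    fiberEnergy u j (Function.update y j τ) = fiberEnergy u j y := by
  rw [fiberEnergy, fiberEnergy, fiberIntercept_update, fiberSlope_update, fiberWeight_update]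
  congr 4
  refine Finset.sum_congr rfl fun i _ => ?_
  by_cases h : i = j <;> simp [h]

theorem measurableEmbedding_potentialMap (hu : IsFiberWeight u j) :
    MeasurableEmbedding (potentialMap u j) :=
  (continuous_potentialMap hu).measurableEmbedding (injective_potentialMap hu)

/-- Change of variables: `G` is the transported integrand divided by the Jacobian, extended by zero
outside the range. -/
theorem exists_lintegral_eq (hu : IsFiberWeight u j) {h : (Fin N → ℝ) → ENNReal}
    (hm : Measurable h) :
    ∃ G : (Fin N → ℝ) → ENNReal, Measurable G ∧ ∫⁻ y, G y = ∫⁻ t, h t ∧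
      (∀ y ∉ Set.range (potentialMap u j), G y = 0) ∧
      ∀ t, G (potentialMap u j t) =
        h t * ENNReal.ofReal |(fiberMatrix u j (potentialMap u j t)).det|⁻¹ := by
  have hemb := measurableEmbedding_potentialMap hu
  have hdet : Measurable fun t => ENNReal.ofReal |(fiberMatrix u j (potentialMap u j t)).det|⁻¹ := by
    have h1 : Continuous fun y : Fin N → ℝ => fiberMatrix u j y := by
      refine continuous_pi fun i => continuous_pi fun k => ?_
      simp only [fiberMatrix, Matrix.of_apply]
      split_ifs <;> fun_prop
    exact ((h1.comp (continuous_potentialMap hu)).matrix_det.abs.measurable.inv).ennreal_ofReal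
  obtain ⟨G, hG, hGe⟩ := hemb.exists_measurable_extend (hm.mul hdet) fun _ => ⟨0⟩
  have hGe' : ∀ t, G (potentialMap u j t) =
      h t * ENNReal.ofReal |(fiberMatrix u j (potentialMap u j t)).det|⁻¹ :=
    fun t => congrFun hGe t
  refine ⟨(Set.range (potentialMap u j)).indicator G, hG.indicator hemb.measurableSet_range, ?_,
    fun y hy => Set.indicator_of_notMem hy _, fun t => ?_⟩
  · rw [lintegral_indicator hemb.measurableSet_range, ← Set.image_univ,
      lintegral_image_eq_lintegral_abs_det_fderiv_mul volume MeasurableSet.univ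
        (fun t _ => (hasFDerivAt_potentialMap hu t).hasFDerivWithinAt)
        (injective_potentialMap hu).injOn, setLIntegral_univ]
    refine lintegral_congr fun t => ?_
    rw [hGe', ContinuousLinearMap.det, LinearMap.coe_toContinuousLinearMap, LinearMap.det_toLin',
      abs_det_potentialDeriv, mul_left_comm, ← ENNReal.ofReal_mul (abs_nonneg _),
      mul_inv_cancel₀ (abs_pos.2 (det_fiberMatrix_ne_zero hu t)).ne', ENNReal.ofReal_one, mul_one]
  · rw [Set.indicator_of_mem (Set.mem_range_self t), hGe']

/-- Two integrals can be compared fibre by fibre. -/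
theorem lintegral_le_of_fiber_le (hu : IsFiberWeight u j) {h₁ h₂ : (Fin N → ℝ) → ENNReal}
    (m₁ : Measurable h₁) (m₂ : Measurable h₂)
    (H : ∀ (t₀ : Fin N → ℝ) (θ : ℝ → Fin N → ℝ),
      (∀ τ, potentialMap u j (θ τ) = Function.update (potentialMap u j t₀) j τ) →
        ∫⁻ τ, h₁ (θ τ) ≤ ∫⁻ τ, h₂ (θ τ)) :
    ∫⁻ t, h₁ t ≤ ∫⁻ t, h₂ t := by
  obtain ⟨G₁, hG₁, e₁, z₁, v₁⟩ := exists_lintegral_eq hu m₁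
  obtain ⟨G₂, hG₂, e₂, z₂, v₂⟩ := exists_lintegral_eq hu m₂
  rw [← e₁, ← e₂]
  refine lintegral_le_of_lmarginal_le (μ := fun _ => volume) {j} hG₁ hG₂ fun y => ?_
  rw [lmarginal_singleton, lmarginal_singleton]
  -- A line parallel to the coordinate `j` either lies entirely in the range or misses it.
  by_cases hy : ∃ τ₀, Function.update y j τ₀ ∈ Set.range (potentialMap u j)
  · obtain ⟨τ₀, t₀, ht₀⟩ := hy
    have hr : ∀ τ, ∃ t, potentialMap u j t = Function.update (potentialMap u j t₀) j τ :=
      update_mem_range_potentialMap hu t₀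
    choose θ hθ using hr
    have hyθ : ∀ τ, Function.update y j τ = potentialMap u j (θ τ) := fun τ => by
      rw [hθ, ht₀, Function.update_idem]
    simp only [hyθ, v₁, v₂]
    simp only [hθ, fiberMatrix_update]
    rw [lintegral_mul_const' _ _ ENNReal.ofReal_ne_top, lintegral_mul_const' _ _ ENNReal.ofReal_ne_top]
    exact mul_le_mul' (H t₀ θ hθ) le_rfl
  · push Not at hy
    simp only [fun τ => z₁ _ (hy τ), fun τ => z₂ _ (hy τ), le_refl]

/-- The positive orthant. -/
def orthant (N : ℕ) : Set (Vertex N → ℝ) := {x | ∀ v, 0 < x v}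

/-- The exponential of the field. -/
noncomputable def expField (t : Fin N → ℝ) (v : Vertex N) : ℝ := Real.exp (pinned t v)

/-- The integrand with a general function of the exponential of the field. -/
noncomputable def fieldIntegrand (W : Weight N) (F : (Vertex N → ℝ) → ℝ) (t : Fin N → ℝ) : ℝ :=
  F (expField t) * Real.exp (-effAction W t)

theorem expField_mem_orthant (t : Fin N → ℝ) : expField t ∈ orthant N := fun _ => Real.exp_pos _

theorem isOpen_orthant : IsOpen (orthant N) := by
  have : orthant N = Set.univ.pi fun _ => Set.Ioi 0 := by
    ext x; simp [orthant]
  rw [this]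
  exact isOpen_set_pi Set.finite_univ fun _ _ => isOpen_Ioi

theorem continuous_pinned (v : Vertex N) : Continuous fun t : Fin N → ℝ => pinned t v :=
  continuous_iff_continuousAt.2 fun t => (hasFDerivAt_pinned v t).continuousAt

theorem continuous_expField : Continuous (expField (N := N)) :=
  continuous_pi fun v => (continuous_pinned v).rexp

theorem continuous_treePoly (W : Weight N) : Continuous (treePoly W) := by
  unfold treePoly
  refine continuous_finsetSum _ fun T _ => continuous_finsetProd _ fun e _ => ?_
  induction e with
  | _ v v' =>
    simp only [edgeFactor, Sym2.lift_mk]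
    exact continuous_const.mul ((continuous_pinned v).add (continuous_pinned v')).rexp

theorem measurable_effAction (W : Weight N) : Measurable (effAction W) := by
  unfold effAction
  have h := (continuous_treePoly W).measurable.log
  have h2 : Measurable fun t : Fin N → ℝ => 1 / 2 * ∑ i : Vertex N, ∑ j : Vertex N,
      W s(i, j) * (Real.cosh (pinned t i - pinned t j) - 1) := by
    refine Continuous.measurable ?_
    refine continuous_const.mul (continuous_finsetSum _ fun v _ => continuous_finsetSum _ fun v' _ => ?_)
    exact continuous_const.mul
      ((Real.continuous_cosh.comp ((continuous_pinned v).sub (continuous_pinned v'))).sub continuous_const)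
  have h3 : Measurable fun t : Fin N → ℝ => 2 * ∑ k, t k := by fun_prop
  exact h2.sub ((h.sub h3).const_mul _)

theorem measurable_fieldIntegrand (W : Weight N) {F : (Vertex N → ℝ) → ℝ}
    (hF : ConvexOn ℝ (orthant N) F) : Measurable (fieldIntegrand W F) :=
  ((hF.continuousOn isOpen_orthant).comp_continuous continuous_expField
    expField_mem_orthant).measurable.mul (measurable_effAction W).neg.exp

/-- On a fibre $e^t$ moves along a straight line with parameter $e^{t_j}$, so `F` restricts to a
convex function there, and the weight enters only through the inverse Gaussian parameter. -/
theorem fieldIntegrand_comparison_root {W : Weight N} (hW : ∀ i j, i ≠ j → 0 < W s(i, j))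
    {F : (Vertex N → ℝ) → ℝ} (hF : ConvexOn ℝ (orthant N) F) (j : Fin N) {w₁ w₂ : ℝ}
    (h₁ : 0 < w₁) (h : w₁ ≤ w₂) :
    posIntegral (fieldIntegrand (Function.update W s(none, some j) w₂) F) +
        negIntegral (fieldIntegrand (Function.update W s(none, some j) w₁) F) ≤
      posIntegral (fieldIntegrand (Function.update W s(none, some j) w₁) F) +
        negIntegral (fieldIntegrand (Function.update W s(none, some j) w₂) F) := by
  have hu := isFiberWeight_wt hW j
  have hm := fun w => measurable_fieldIntegrand (Function.update W s(none, some j) w) hF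
  unfold posIntegral negIntegral
  rw [← lintegral_add_left (hm w₂).ennreal_ofReal, ← lintegral_add_left (hm w₁).ennreal_ofReal]
  refine lintegral_le_of_fiber_le hu ((hm w₂).ennreal_ofReal.add (hm w₁).neg.ennreal_ofReal)
    ((hm w₁).ennreal_ofReal.add (hm w₂).neg.ennreal_ofReal) fun t₀ θ hθ => ?_
  set u := wt (Function.update W s(none, some j) 0)
  set y := potentialMap u j t₀ with hy
  -- The root has intercept one and slope zero, since $e^{t_\delta}=1$.
  set β : Vertex N → ℝ := fun v => v.elim 1 (fiberIntercept u j y)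
  set α : Vertex N → ℝ := fun v => v.elim 0 (fiberSlope u j y)
  set g : ℝ → ℝ := fun s => F (β + s • α) with hgdef
  have hθj : ∀ τ, θ τ j = τ := fun τ => by
    simpa [potentialMap] using congrFun (hθ τ) j
  have hexp : ∀ τ, expField (θ τ) = β + Real.exp τ • α := fun τ => by
    funext v
    rcases v with _ | k
    · simp [expField, pinned, β, α]
    · have := exp_eq_affine hu (θ τ) k
      rw [hθ τ, fiberIntercept_update, fiberSlope_update, hθj] at this
      simpa [expField, pinned, β, α] using this
  have hg : ConvexOn ℝ (Set.Ioi 0) g := by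
    have hmem : ∀ s : ℝ, 0 < s → β + s • α ∈ orthant N := fun s hs v => by
      rcases v with _ | k
      · simp [β, α]
      · simpa [β, α] using fiber_affine_pos hu t₀ hs k
    refine ⟨convex_Ioi 0, fun a ha b hb p q hp hq hpq => ?_⟩
    have := hF.2 (hmem a ha) (hmem b hb) hp hq hpq
    convert this using 2
    funext v
    simp only [Pi.add_apply, Pi.smul_apply, smul_eq_mul]
    linear_combination (-β v) * hpq
  set κ : ℝ := Real.sqrt |(fiberMatrix u j y).det| * Real.exp (-fiberEnergy u j y)
  have hκ : 0 ≤ κ := by positivity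
  have hval : ∀ w, 0 < w → ∀ τ, fieldIntegrand (Function.update W s(none, some j) w) F (θ τ) =
      κ * (g (Real.exp τ) * igDensity (w + fiberWeight u j y) τ) := by
    intro w hw τ
    rw [fieldIntegrand, exp_neg_effAction hu hw (θ τ) (hθ τ).symm, hexp, hθj, fiberMatrix_update,
      fiberEnergy_update, fiberWeight_update]
    ring
  have hc := fiberWeight_nonneg hu t₀
  simp only [hval w₁ h₁, hval w₂ (h₁.trans_le h), ← mul_neg, ENNReal.ofReal_mul hκ, ← mul_add]
  rw [lintegral_const_mul' _ _ ENNReal.ofReal_ne_top, lintegral_const_mul' _ _ ENNReal.ofReal_ne_top]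
  have hw₁ : 0 < w₁ + fiberWeight u j y := by linarith
  exact mul_le_mul' le_rfl (by
    simpa only [mul_neg] using lintegral_convex_igDensity_le hg hw₁ (add_le_add h le_rfl))

end FiberIntegral

/-! ### Change of root for homogeneous functions. -/

section RootChange

variable {N : ℕ}

theorem exists_isTree : ∃ T : SimpleGraph (Vertex N), T.IsTree :=
  ⟨parentGraph fun _ => none, IsRooted.isTree ⟨fun _ => 0, fun _ _ h => by simp at h⟩⟩

theorem edgeFactor_pos {W : Weight N} (hW : ∀ i j, i ≠ j → 0 < W s(i, j)) (t : Fin N → ℝ)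
    {T : SimpleGraph (Vertex N)} {e : Sym2 (Vertex N)} (he : e ∈ T.edgeSet) :
    0 < W e ∧ 0 < edgeFactor W t e := by
  induction e with
  | _ v v' =>
    have h : v ≠ v' := T.ne_of_adj he
    refine ⟨hW v v' h, ?_⟩
    simp only [edgeFactor, Sym2.lift_mk]
    exact mul_pos (hW v v' h) (Real.exp_pos _)

theorem treePoly_pos {W : Weight N} (hW : ∀ i j, i ≠ j → 0 < W s(i, j)) (t : Fin N → ℝ) :
    0 < treePoly W t := by
  classical
  obtain ⟨T, hT⟩ := exists_isTree (N := N)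
  refine Finset.sum_pos (fun T _ => Finset.prod_pos fun e he => ?_) ⟨T, by simpa using hT⟩
  exact (edgeFactor_pos hW t (SimpleGraph.mem_edgeFinset.1 he)).2

/-- The exchange of the root with the vertex `i`. -/
def rootSwap (i : Fin N) : Equiv.Perm (Vertex N) := Equiv.swap none (some i)

theorem rootSwap_rootSwap (i : Fin N) (v : Vertex N) : rootSwap i (rootSwap i v) = v :=
  Equiv.swap_apply_self _ _ _

theorem sym2Map_rootSwap_involutive (i : Fin N) :
    Function.Involutive (Sym2.map (rootSwap i)) := by
  intro e
  induction e with
  | _ v v' => simp [rootSwap_rootSwap]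

/-- The field pinned at `i` instead of the root, after the exchange of these two vertices. -/
def repin (i : Fin N) : (Fin N → ℝ) →ₗ[ℝ] (Fin N → ℝ) where
  toFun t k := if k = i then -t i else t k - t i
  map_add' s t := by ext k; simp only [Pi.add_apply]; split_ifs <;> ring
  map_smul' c t := by
    ext k; simp only [Pi.smul_apply, smul_eq_mul, RingHom.id_apply]; split_ifs <;> ring

theorem pinned_repin (i : Fin N) (t : Fin N → ℝ) (v : Vertex N) :
    pinned (repin i t) v = pinned t (rootSwap i v) - t i := by
  rcases v with _ | k
  · simp [rootSwap, pinned]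
  · by_cases h : k = i
    · subst h; simp [rootSwap, pinned, repin]
    · have : rootSwap i (some k) = some k :=
        Equiv.swap_apply_of_ne_of_ne (by simp) (by simpa using h)
      simp [this, pinned, repin, h]

theorem repin_repin (i : Fin N) (t : Fin N → ℝ) : repin i (repin i t) = t := by
  ext k
  by_cases h : k = i
  · subst h; simp [repin]
  · simp [repin, h]

theorem measurePreserving_repin (i : Fin N) : MeasurePreserving (repin (N := N) i) := by
  have h1 : LinearMap.det (repin i) * LinearMap.det (repin i) = 1 := by
    rw [← LinearMap.det_comp, show repin i ∘ₗ repin i = LinearMap.id from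
      LinearMap.ext fun t => repin_repin i t, LinearMap.det_id]
  refine ⟨(LinearMap.continuous_of_finiteDimensional _).measurable, ?_⟩
  rw [Real.map_linearMap_volume_pi_eq_smul_volume_pi (left_ne_zero_of_mul_eq_one h1), abs_inv]
  have h2 : |LinearMap.det (repin i)| = 1 := by
    rw [← sq_eq_sq₀ (abs_nonneg _) zero_le_one, sq_abs, sq, h1, one_pow]
  rw [h2, inv_one, ENNReal.ofReal_one, one_smul]

theorem edgeFactor_repin (W : Weight N) (i : Fin N) (t : Fin N → ℝ) (e : Sym2 (Vertex N)) :
    edgeFactor (W ∘ Sym2.map (rootSwap i)) (repin i t) e =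
      Real.exp (-2 * t i) * edgeFactor W t (Sym2.map (rootSwap i) e) := by
  induction e with
  | _ v v' =>
    simp only [edgeFactor, Sym2.lift_mk, Sym2.map_mk, Function.comp_apply, pinned_repin]
    rw [mul_left_comm, ← Real.exp_add]
    congr 2
    ring

/-- Every spanning tree has $N$ edges, and each of them gains a factor $e^{-2t_i}$. -/
theorem treePoly_repin (W : Weight N) (i : Fin N) (t : Fin N → ℝ) :
    treePoly (W ∘ Sym2.map (rootSwap i)) (repin i t) =
      Real.exp (-2 * t i) ^ N * treePoly W t := by
  classical
  unfold treePoly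
  rw [Finset.mul_sum]
  have hmm : ∀ T : SimpleGraph (Vertex N),
      (T.map (rootSwap i).toEmbedding).map (rootSwap i).toEmbedding = T := fun T => by
    rw [SimpleGraph.map_map, show (rootSwap i).toEmbedding ∘ (rootSwap i).toEmbedding = id from
      funext (rootSwap_rootSwap i), SimpleGraph.map_id]
  refine Finset.sum_nbij' (fun T => T.map (rootSwap i).toEmbedding)
    (fun T => T.map (rootSwap i).toEmbedding) ?_ ?_ (fun T _ => hmm T) (fun T _ => hmm T) ?_
  · intro T hT
    simp only [Finset.mem_filter, Finset.mem_univ, true_and] at hT ⊢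
    exact (SimpleGraph.Iso.isTree_iff (SimpleGraph.Iso.map (rootSwap i) T)).1 hT
  · intro T hT
    simp only [Finset.mem_filter, Finset.mem_univ, true_and] at hT ⊢
    exact (SimpleGraph.Iso.isTree_iff (SimpleGraph.Iso.map (rootSwap i) T)).1 hT
  · intro T hT
    simp only [Finset.mem_filter, Finset.mem_univ, true_and] at hT
    simp only [edgeFactor_repin]
    rw [Finset.prod_mul_distrib, Finset.prod_const]
    have hcard := hT.card_edgeFinset
    rw [Fintype.card_option, Fintype.card_fin, Nat.add_right_cancel_iff] at hcard
    have hmem : ∀ (G : SimpleGraph (Vertex N)) (inst : Fintype G.edgeSet)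
        (e : Sym2 (Vertex N)), e ∈ G.edgeFinset ↔ e ∈ G.edgeSet := fun G _ e => SimpleGraph.mem_edgeFinset
    congr 1
    · congr 1
    · refine Finset.prod_nbij (Sym2.map (rootSwap i)) (fun e he => ?_)
        ((sym2Map_rootSwap_involutive i).injective.injOn) (fun e he => ?_) fun _ _ => rfl
      · refine (hmem _ _ _).2 ?_
        rw [SimpleGraph.edgeSet_map]
        exact ⟨e, (hmem _ _ _).1 he, rfl⟩
      · have he1 := (hmem _ _ _).1 he
        rw [SimpleGraph.edgeSet_map] at he1
        obtain ⟨e', he', rfl⟩ := he1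
        exact ⟨e', by simpa using he', rfl⟩

/-- The energy sees only differences of the field. The logarithm of the tree polynomial contributes
$+Nt_i$ and the sum of the field $-(N+1)t_i$, which leaves $-t_i$. -/
theorem effAction_repin {W : Weight N} (hW : ∀ i j, i ≠ j → 0 < W s(i, j)) (i : Fin N)
    (t : Fin N → ℝ) :
    effAction (W ∘ Sym2.map (rootSwap i)) (repin i t) = effAction W t - t i := by
  have h1 : ∑ v : Vertex N, ∑ v' : Vertex N, (W ∘ Sym2.map (rootSwap i)) s(v, v') *
      (Real.cosh (pinned (repin i t) v - pinned (repin i t) v') - 1) =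
      ∑ v : Vertex N, ∑ v' : Vertex N, W s(v, v') * (Real.cosh (pinned t v - pinned t v') - 1) := by
    rw [← Equiv.sum_comp (rootSwap i)]
    refine Finset.sum_congr rfl fun v _ => ?_
    rw [← Equiv.sum_comp (rootSwap i)]
    refine Finset.sum_congr rfl fun v' _ => ?_
    simp [pinned_repin, rootSwap_rootSwap]
  have h2 : ∀ s : Fin N → ℝ, ∑ k, s k = ∑ v, pinned s v := fun s => by
    simp [Fintype.sum_option, pinned]
  have h3 : ∑ k, repin i t k = ∑ k, t k - (N + 1) * t i := by
    rw [h2, h2]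
    simp only [pinned_repin]
    rw [Finset.sum_sub_distrib, Equiv.sum_comp (rootSwap i) (pinned t)]
    simp
  unfold effAction
  rw [h1, h3, treePoly_repin, Real.log_mul (by positivity) (treePoly_pos hW t).ne', Real.log_pow,
    Real.log_exp]
  ring

theorem fieldIntegrand_repin {W : Weight N} (hW : ∀ i j, i ≠ j → 0 < W s(i, j))
    {F : (Vertex N → ℝ) → ℝ} (hF : ∀ s : ℝ, 0 < s → ∀ x ∈ orthant N, F (s • x) = s * F x)
    (i : Fin N) (t : Fin N → ℝ) :
    fieldIntegrand (W ∘ Sym2.map (rootSwap i)) (fun x => F (x ∘ rootSwap i)) (repin i t) =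
      fieldIntegrand W F t := by
  have h1 : expField (repin i t) ∘ rootSwap i = Real.exp (-t i) • expField t := by
    funext v
    simp only [expField, Function.comp_apply, pinned_repin, rootSwap_rootSwap, Pi.smul_apply,
      smul_eq_mul]
    rw [← Real.exp_add]
    ring_nf
  rw [fieldIntegrand, fieldIntegrand, h1, hF _ (Real.exp_pos _) _ (expField_mem_orthant t),
    effAction_repin hW, neg_sub, sub_eq_add_neg, Real.exp_add]
  have : Real.exp (-t i) * Real.exp (t i) = 1 := by rw [← Real.exp_add]; simp
  linear_combination (F (expField t) * Real.exp (-effAction W t)) * this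

theorem convexOn_comp_rootSwap {F : (Vertex N → ℝ) → ℝ} (hF : ConvexOn ℝ (orthant N) F)
    (i : Fin N) : ConvexOn ℝ (orthant N) fun x => F (x ∘ rootSwap i) :=
  ⟨hF.1, fun _ hx _ hy _ _ ha hb hab =>
    hF.2 (fun v => hx (rootSwap i v)) (fun v => hy (rootSwap i v)) ha hb hab⟩

theorem posIntegral_repin {g : (Fin N → ℝ) → ℝ} (hg : Measurable g) (i : Fin N) :
    posIntegral (fun t => g (repin i t)) = posIntegral g :=
  (measurePreserving_repin i).lintegral_comp hg.ennreal_ofReal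

theorem update_comp_rootSwap (W : Weight N) (i : Fin N) (e : Sym2 (Vertex N)) (w : ℝ) :
    Function.update W e w ∘ Sym2.map (rootSwap i) =
      Function.update (W ∘ Sym2.map (rootSwap i)) (Sym2.map (rootSwap i) e) w := by
  have hi := sym2Map_rootSwap_involutive i
  funext e'
  simp only [Function.comp_apply, Function.update_apply, hi.eq_iff, eq_comm (a := e')]

theorem update_pos_of_pos {W : Weight N} (hW : ∀ i j, i ≠ j → 0 < W s(i, j)) (e : Sym2 (Vertex N))
    {w : ℝ} (hw : 0 < w) (i j : Vertex N) (hij : i ≠ j) : 0 < Function.update W e w s(i, j) := by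
  rw [Function.update_apply]
  split_ifs
  exacts [hw, hW i j hij]

/-- The comparison of the integrals when the weight of one edge grows. -/
def IsMonotoneEdge (W : Weight N) (F : (Vertex N → ℝ) → ℝ) (e : Sym2 (Vertex N)) : Prop :=
  ∀ w₁ w₂ : ℝ, 0 < w₁ → w₁ ≤ w₂ →
    posIntegral (fieldIntegrand (Function.update W e w₂) F) +
        negIntegral (fieldIntegrand (Function.update W e w₁) F) ≤
      posIntegral (fieldIntegrand (Function.update W e w₁) F) +
        negIntegral (fieldIntegrand (Function.update W e w₂) F)

theorem isMonotoneEdge_some_some {W : Weight N} (hW : ∀ i j, i ≠ j → 0 < W s(i, j))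
    {F : (Vertex N → ℝ) → ℝ} (hF : ConvexOn ℝ (orthant N) F)
    (hF' : ∀ s : ℝ, 0 < s → ∀ x ∈ orthant N, F (s • x) = s * F x)
    {i j : Fin N} (hij : i ≠ j) : IsMonotoneEdge W F s(some i, some j) := by
  intro w₁ w₂ h₁ h
  have hconv := convexOn_comp_rootSwap hF i
  have hj : rootSwap i (some j) = some j :=
    Equiv.swap_apply_of_ne_of_ne (by simp) (by simpa using hij.symm)
  have hi : rootSwap i (some i) = none := Equiv.swap_apply_right _ _
  have key : ∀ w, 0 < w → fieldIntegrand (Function.update W s(some i, some j) w) F = fun t =>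
      fieldIntegrand (Function.update (W ∘ Sym2.map (rootSwap i)) s(none, some j) w)
        (fun x => F (x ∘ rootSwap i)) (repin i t) := by
    intro w hw
    funext t
    rw [← fieldIntegrand_repin (update_pos_of_pos hW _ hw) hF' i t, update_comp_rootSwap,
      Sym2.map_mk, hi, hj]
  have hm := fun w => measurable_fieldIntegrand
    (Function.update (W ∘ Sym2.map (rootSwap i)) s(none, some j) w) hconv
  have hpos : ∀ w, 0 < w → posIntegral (fieldIntegrand (Function.update W s(some i, some j) w) F) =
      posIntegral (fieldIntegrand (Function.update (W ∘ Sym2.map (rootSwap i)) s(none, some j) w)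
        (fun x => F (x ∘ rootSwap i))) := fun w hw => by
    rw [key w hw, posIntegral_repin (hm w)]
  have hneg : ∀ w, 0 < w → negIntegral (fieldIntegrand (Function.update W s(some i, some j) w) F) =
      negIntegral (fieldIntegrand (Function.update (W ∘ Sym2.map (rootSwap i)) s(none, some j) w)
        (fun x => F (x ∘ rootSwap i))) := fun w hw => by
    rw [key w hw]
    exact posIntegral_repin (hm w).neg i
  have h₂ := h₁.trans_le h
  rw [hpos w₁ h₁, hpos w₂ h₂, hneg w₁ h₁, hneg w₂ h₂]
  exact fieldIntegrand_comparison_root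
    (fun v v' hv => hW (rootSwap i v) (rootSwap i v') ((rootSwap i).injective.ne hv)) hconv j h₁ h

theorem fieldIntegrand_update_diag (W : Weight N) (F : (Vertex N → ℝ) → ℝ) (v : Vertex N) (w : ℝ) :
    fieldIntegrand (Function.update W s(v, v) w) F = fieldIntegrand W F := by
  have h : wt (Function.update W s(v, v) w) = wt W := by
    funext a b
    by_cases hab : a = b
    · simp [wt, hab]
    · have : s(a, b) ≠ s(v, v) := by
        intro h
        rcases Sym2.eq_iff.1 h with ⟨rfl, rfl⟩ | ⟨rfl, rfl⟩ <;> exact hab rfl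
      simp only [wt, Function.update_of_ne this]
  funext t
  simp only [fieldIntegrand, effAction_eq, treePoly_eq_det, reducedLaplacian_edgeFactor, h]

theorem isMonotoneEdge {W : Weight N} (hW : ∀ i j, i ≠ j → 0 < W s(i, j))
    {F : (Vertex N → ℝ) → ℝ} (hF : ConvexOn ℝ (orthant N) F)
    (hF' : ∀ s : ℝ, 0 < s → ∀ x ∈ orthant N, F (s • x) = s * F x)
    (v v' : Vertex N) : IsMonotoneEdge W F s(v, v') := by
  rcases eq_or_ne v v' with rfl | hv
  · intro w₁ w₂ _ _
    rw [fieldIntegrand_update_diag, fieldIntegrand_update_diag]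
  rcases v with _ | i <;> rcases v' with _ | k
  · exact absurd rfl hv
  · exact fun w₁ w₂ h₁ h => fieldIntegrand_comparison_root hW hF k h₁ h
  · rw [Sym2.eq_swap]
    exact fun w₁ w₂ h₁ h => fieldIntegrand_comparison_root hW hF i h₁ h
  · exact isMonotoneEdge_some_some hW hF hF' (by simpa using hv)

end RootChange

/-! ### The perspective of a convex function. -/

section Perspective

variable {N : ℕ} {p : Fin N → ℝ} {f : ℝ → ℝ}

/-- The homogeneous function of degree one that gives back `f (∑ p_k x_k)` when the coordinate of
the root is one. -/
noncomputable def perspective (p : Fin N → ℝ) (f : ℝ → ℝ) (x : Vertex N → ℝ) : ℝ :=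
  x none * f ((∑ k, p k * x (some k)) / x none)

theorem perspective_smul (p : Fin N → ℝ) (f : ℝ → ℝ) (s : ℝ) (hs : 0 < s) (x : Vertex N → ℝ) :
    perspective p f (s • x) = s * perspective p f x := by
  simp only [perspective, Pi.smul_apply, smul_eq_mul]
  have h : ∑ k, p k * (s * x (some k)) = s * ∑ k, p k * x (some k) := by
    rw [Finset.mul_sum]
    exact Finset.sum_congr rfl fun k _ => by ring
  rw [h, mul_div_mul_left _ _ hs.ne', mul_assoc]

/-- Convexity of `f` is applied to the two quotients with weights $ax_\delta/X$ and $by_\delta/X$,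
whose sum is one. -/
theorem convexOn_perspective (p : Fin N → ℝ) (hf : ConvexOn ℝ Set.univ f) :
    ConvexOn ℝ (orthant N) (perspective p f) := by
  have hc : Convex ℝ (orthant N) := by
    have : orthant N = Set.univ.pi fun _ => Set.Ioi 0 := by
      ext x; simp [orthant]
    rw [this]
    exact convex_pi fun _ _ => convex_Ioi 0
  refine ⟨hc, fun x hx y hy a b ha hb hab => ?_⟩
  have hX : 0 < a * x none + b * y none := hc hx hy ha hb hab none
  have hx0 := hx none
  have hy0 := hy none
  simp only [perspective, Pi.add_apply, Pi.smul_apply, smul_eq_mul]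
  set X := a * x none + b * y none with hXdef
  set P := ∑ k, p k * x (some k)
  set Q := ∑ k, p k * y (some k)
  have hsum : ∑ k, p k * (a * x (some k) + b * y (some k)) = a * P + b * Q := by
    simp only [P, Q, Finset.mul_sum, ← Finset.sum_add_distrib]
    exact Finset.sum_congr rfl fun k _ => by ring
  have h := hf.2 (Set.mem_univ (P / x none)) (Set.mem_univ (Q / y none))
    (div_nonneg (mul_nonneg ha hx0.le) hX.le) (div_nonneg (mul_nonneg hb hy0.le) hX.le)
    (by rw [← add_div, ← hXdef, div_self hX.ne'])
  simp only [smul_eq_mul] at h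
  have e1 : a * x none / X * (P / x none) + b * y none / X * (Q / y none) =
      (a * P + b * Q) / X := by
    field_simp
  rw [e1] at h
  rw [hsum]
  calc X * f ((a * P + b * Q) / X)
      ≤ X * (a * x none / X * f (P / x none) + b * y none / X * f (Q / y none)) :=
        mul_le_mul_of_nonneg_left h hX.le
    _ = _ := by field_simp

theorem fieldIntegrand_perspective (W : Weight N) (p : Fin N → ℝ) (f : ℝ → ℝ) :
    fieldIntegrand W (perspective p f) = integrand W p f := by
  funext t
  simp [fieldIntegrand, perspective, integrand, expField, pinned]

end Perspective

/-! ### Integrability of the negative part. -/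

section Finiteness

variable {N : ℕ}

theorem sq_div_four_sub_le_cosh_sub_one (τ : ℝ) : τ ^ 2 / 4 - 1 / 2 ≤ Real.cosh τ - 1 := by
  have h := Real.quadratic_le_exp_of_nonneg (abs_nonneg τ)
  rw [← Real.cosh_abs, Real.cosh_eq, ← sq_abs]
  have := Real.exp_pos (-|τ|)
  have := abs_nonneg τ
  linarith

theorem integrable_exp_mul_abs_sub_cosh (M : ℝ) {c : ℝ} (hc : 0 < c) :
    Integrable fun τ : ℝ => Real.exp (M * |τ| - c * (Real.cosh τ - 1)) := by
  -- Half of the quadratic bound $c\tau^2/4$ absorbs $M|\tau|$ at the cost $2M^2/c$ by completing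
  -- the square. The other half leaves a Gaussian.
  refine ((integrable_exp_neg_mul_sq (b := c / 8) (by positivity)).const_mul
    (Real.exp (2 * M ^ 2 / c + c / 2))).mono' (by fun_prop) (Filter.Eventually.of_forall fun τ => ?_)
  rw [Real.norm_of_nonneg (Real.exp_pos _).le, ← Real.exp_add, Real.exp_le_exp]
  have h1 := mul_le_mul_of_nonneg_left (sq_div_four_sub_le_cosh_sub_one τ) hc.le
  have h2 : 0 ≤ c / 8 * (|τ| - 4 * M / c) ^ 2 := by positivity
  have h3 : c / 8 * (|τ| - 4 * M / c) ^ 2 = c / 8 * τ ^ 2 - M * |τ| + 2 * M ^ 2 / c := by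
    rw [← sq_abs τ]; field_simp; ring
  linarith

theorem sum_mul_cosh_le_energy {u : Vertex N → Vertex N → ℝ} (hu : ∀ v v', 0 ≤ u v v')
    (t : Fin N → ℝ) {c : ℝ} (h1 : ∀ k, c ≤ u (some k) none) (h2 : ∀ k, c ≤ u none (some k)) :
    ∑ k, c * (Real.cosh (t k) - 1) ≤ energy u t := by
  have hc : ∀ x : ℝ, 0 ≤ Real.cosh x - 1 := fun x => sub_nonneg.2 (Real.one_le_cosh x)
  have ha : ∑ k, c * (Real.cosh (t k) - 1) ≤ ∑ v' : Vertex N,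
      u none v' * (Real.cosh (pinned t none - pinned t v') - 1) := by
    rw [Fintype.sum_option]
    refine le_add_of_nonneg_of_le (mul_nonneg (hu _ _) (hc _)) (Finset.sum_le_sum fun k _ => ?_)
    simp only [pinned, Option.elim, zero_sub, Real.cosh_neg]
    exact mul_le_mul_of_nonneg_right (h2 k) (hc _)
  have hb : ∑ k, c * (Real.cosh (t k) - 1) ≤ ∑ k : Fin N, ∑ v' : Vertex N,
      u (some k) v' * (Real.cosh (pinned t (some k) - pinned t v') - 1) := by
    refine Finset.sum_le_sum fun k _ => ?_
    rw [Fintype.sum_option]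
    refine le_add_of_le_of_nonneg ?_ (Finset.sum_nonneg fun l _ => mul_nonneg (hu _ _) (hc _))
    simp only [pinned, Option.elim, sub_zero]
    exact mul_le_mul_of_nonneg_right (h1 k) (hc _)
  rw [energy, Fintype.sum_option]
  linarith

theorem abs_pinned_le (t : Fin N → ℝ) (v : Vertex N) : |pinned t v| ≤ ∑ k, |t k| := by
  rcases v with _ | k
  · simpa [pinned] using Finset.sum_nonneg fun k _ => abs_nonneg (t k)
  · exact Finset.single_le_sum (f := fun k => |t k|) (fun k _ => abs_nonneg _) (Finset.mem_univ k)

theorem exists_treePoly_le {W : Weight N} (hW : ∀ i j, i ≠ j → 0 < W s(i, j)) :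
    ∃ C : ℝ, 0 ≤ C ∧ ∀ t : Fin N → ℝ, treePoly W t ≤ C * Real.exp (2 * ∑ k, |t k|) ^ N := by
  classical
  refine ⟨∑ T : SimpleGraph (Vertex N) with T.IsTree, ∏ e ∈ T.edgeFinset, W e,
    Finset.sum_nonneg fun T _ => Finset.prod_nonneg fun e he => ?_, fun t => ?_⟩
  · exact (edgeFactor_pos hW 0 (SimpleGraph.mem_edgeFinset.1 he)).1.le
  · unfold treePoly
    rw [Finset.sum_mul]
    refine Finset.sum_le_sum fun T hT => ?_
    simp only [Finset.mem_filter, Finset.mem_univ, true_and] at hT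
    have hcard := hT.card_edgeFinset
    rw [Fintype.card_option, Fintype.card_fin, Nat.add_right_cancel_iff] at hcard
    calc ∏ e ∈ T.edgeFinset, edgeFactor W t e
        ≤ ∏ e ∈ T.edgeFinset, W e * Real.exp (2 * ∑ k, |t k|) := by
          refine Finset.prod_le_prod (fun e he => ?_) fun e he => ?_
          · exact (edgeFactor_pos hW t (SimpleGraph.mem_edgeFinset.1 he)).2.le
          · have h := (edgeFactor_pos hW t (SimpleGraph.mem_edgeFinset.1 he)).1.le
            refine mul_le_mul_of_nonneg_left ?_ h
            induction e with
            | _ v v' =>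
              simp only [Sym2.lift_mk, Real.exp_le_exp]
              have h1 := (le_abs_self _).trans (abs_pinned_le t v)
              have h2 := (le_abs_self _).trans (abs_pinned_le t v')
              linarith
      _ = _ := by
          rw [Finset.prod_mul_distrib, Finset.prod_const]
          congr 2

theorem integrable_exp_sum_abs_mul_exp_neg_effAction {W : Weight N}
    (hW : ∀ i j, i ≠ j → 0 < W s(i, j)) :
    Integrable fun t : Fin N → ℝ => Real.exp (∑ k, |t k|) * Real.exp (-effAction W t) := by
  obtain ⟨C, hC, hCt⟩ := exists_treePoly_le hW
  obtain ⟨c, hc, hcW⟩ : ∃ c : ℝ, 0 < c ∧ ∀ k : Fin N, c ≤ W s(some k, none) := by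
    rcases isEmpty_or_nonempty (Fin N) with h | h
    · exact ⟨1, one_pos, fun k => h.elim k⟩
    · obtain ⟨k, hk⟩ := Finite.exists_min fun k : Fin N => W s(some k, none)
      exact ⟨_, hW _ _ (by simp), hk⟩
  -- In $N+2$, the $N$ comes from the square root of the tree polynomial, one unit from $-\sum_k
  -- t_k$, and one from the factor $e^{\sum_k|t_k|}$.
  have hint : Integrable fun t : Fin N → ℝ =>
      ∏ k, Real.exp ((N + 2 : ℝ) * |t k| - c * (Real.cosh (t k) - 1)) :=
    Integrable.fintype_prod fun _ => integrable_exp_mul_abs_sub_cosh _ hc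
  refine (hint.const_mul (Real.sqrt C)).mono' ?_ (Filter.Eventually.of_forall fun t => ?_)
  · have h1 : Measurable fun t : Fin N → ℝ => Real.exp (∑ k, |t k|) := by
      refine Continuous.measurable ?_
      fun_prop
    exact (h1.mul (measurable_effAction W).neg.exp).aestronglyMeasurable
  have hwt : ∀ k : Fin N, wt W (some k) none = W s(some k, none) := fun k => by simp [wt]
  have hwt' : ∀ k : Fin N, wt W none (some k) = W s(some k, none) := fun k => by
    rw [wt_comm, hwt]
  have hE := sum_mul_cosh_le_energy (u := wt W) (fun v v' => by
      unfold wt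
      split_ifs with h
      exacts [le_rfl, (hW v v' h).le]) t (fun k => (hcW k).trans_eq (hwt k).symm)
    (fun k => (hcW k).trans_eq (hwt' k).symm)
  have hD := treePoly_pos hW t
  set s := ∑ k, |t k| with hs
  have hsum : -∑ k, t k ≤ s := (neg_le_abs _).trans (Finset.abs_sum_le_sum_abs _ _)
  have hsqrt : Real.exp (1 / 2 * Real.log (treePoly W t)) ≤ Real.sqrt C * Real.exp (N * s) := by
    have e1 : Real.exp (1 / 2 * Real.log (treePoly W t)) = Real.sqrt (treePoly W t) := by
      rw [Real.sqrt_eq_rpow, Real.rpow_def_of_pos hD, mul_comm]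
    rw [e1, show Real.exp (N * s) = Real.sqrt (Real.exp (2 * s) ^ N) by
      rw [← Real.exp_nat_mul, show (N : ℝ) * (2 * s) = N * s + N * s by ring, Real.exp_add,
        Real.sqrt_mul_self (Real.exp_pos _).le], ← Real.sqrt_mul hC]
    exact Real.sqrt_le_sqrt (hCt t)
  rw [Real.norm_of_nonneg (by positivity), effAction_eq, ← Real.exp_add, ← Real.exp_sum,
    Finset.sum_sub_distrib, ← Finset.mul_sum, ← hs]
  calc Real.exp (s + -(energy (wt W) t - 1 / 2 * (Real.log (treePoly W t) - 2 * ∑ k, t k)))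
      = Real.exp (1 / 2 * Real.log (treePoly W t)) *
          Real.exp (s - energy (wt W) t - ∑ k, t k) := by
        rw [← Real.exp_add]; congr 1; ring
    _ ≤ Real.sqrt C * Real.exp (N * s) *
          Real.exp (2 * s - ∑ k, c * (Real.cosh (t k) - 1)) := by
        refine mul_le_mul hsqrt (Real.exp_le_exp.2 ?_) (Real.exp_pos _).le (by positivity)
        linarith
    _ = _ := by
        rw [mul_assoc, ← Real.exp_add]; congr 2; ring

theorem exists_le_of_convexOn {f : ℝ → ℝ} (hf : ConvexOn ℝ Set.univ f) :
    ∃ A : ℝ, 0 ≤ A ∧ ∀ x, 0 ≤ x → -f x ≤ A * (1 + x) := by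
  -- To the right of $0$, `f` lies above the line through its values at $-1$ and $0$.
  refine ⟨|f 0| + |f 0 - f (-1)|, by positivity, fun x hx => ?_⟩
  have h : f 0 + (f 0 - f (-1)) * x ≤ f x := by
    rcases hx.eq_or_lt with rfl | hx
    · simp
    · have := ConvexOn.chord_le_of_notMem hf (Set.mem_univ (-1)) (Set.mem_univ 0) (Set.mem_univ x)
        (by norm_num) (Or.inr hx)
      norm_num at this
      linarith
  have h1 := neg_le_abs (f 0)
  have h2 := mul_le_mul_of_nonneg_right (neg_le_abs (f 0 - f (-1))) hx
  have h3 := mul_nonneg (abs_nonneg (f 0)) hx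
  have h4 := abs_nonneg (f 0 - f (-1))
  linarith

theorem negIntegral_integrand_lt_top {W : Weight N} (hW : ∀ i j, i ≠ j → 0 < W s(i, j))
    {p : Fin N → ℝ} (hp : ∀ k, 0 ≤ p k) {f : ℝ → ℝ} (hf : ConvexOn ℝ Set.univ f) :
    negIntegral (integrand W p f) < ⊤ := by
  obtain ⟨A, hA, hAf⟩ := exists_le_of_convexOn hf
  have hint := (integrable_exp_sum_abs_mul_exp_neg_effAction hW).const_mul (A * (1 + ∑ k, p k))
  refine lt_of_le_of_lt (lintegral_mono fun t => ENNReal.ofReal_le_ofReal ?_) hint.lintegral_lt_top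
  rw [integrand, ← neg_mul, ← mul_assoc]
  refine mul_le_mul_of_nonneg_right ((hAf _ (Finset.sum_nonneg fun k _ =>
    mul_nonneg (hp k) (Real.exp_pos _).le)).trans ?_) (Real.exp_pos _).le
  rw [mul_assoc]
  refine mul_le_mul_of_nonneg_left ?_ hA
  have h0 : 1 ≤ Real.exp (∑ k, |t k|) :=
    Real.one_le_exp (Finset.sum_nonneg fun k _ => abs_nonneg (t k))
  rw [add_mul, one_mul, Finset.sum_mul]
  refine add_le_add h0 (Finset.sum_le_sum fun k _ => mul_le_mul_of_nonneg_left ?_ (hp k))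
  exact Real.exp_le_exp.2 ((le_abs_self _).trans (abs_pinned_le t (some k)))

theorem extIntegral_le_of_add_le {g₁ g₂ : (Fin N → ℝ) → ℝ} (h₁ : negIntegral g₁ < ⊤)
    (h₂ : negIntegral g₂ < ⊤)
    (h : posIntegral g₂ + negIntegral g₁ ≤ posIntegral g₁ + negIntegral g₂) :
    extIntegral g₂ ≤ extIntegral g₁ := by
  unfold extIntegral
  have h' : (posIntegral g₂ : EReal) + negIntegral g₁ ≤ posIntegral g₁ + negIntegral g₂ := by
    exact_mod_cast h
  lift negIntegral g₁ to NNReal using h₁.ne with a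
  lift negIntegral g₂ to NNReal using h₂.ne with b
  generalize (posIntegral g₂ : EReal) = P at *
  generalize (posIntegral g₁ : EReal) = Q at *
  rw [EReal.sub_le_iff_le_add (Or.inl (by simp)) (Or.inl (by simp)), sub_eq_add_neg,
    add_right_comm, ← sub_eq_add_neg]
  exact (EReal.le_sub_iff_add_le (Or.inl (by simp)) (Or.inl (by simp))).2 h'

end Finiteness

end H22

theorem mainTheorem2 (N : ℕ) (hN : 1 ≤ N) (p : Fin N → ℝ) (hp : ∀ k, 0 ≤ p k)
    (f : ℝ → ℝ) (hf : ConvexOn ℝ Set.univ f) :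
    -- for positive weights the integral is well defined, with a value in `(-∞, +∞]`
    (∀ W : H22.Weight N, (∀ i j, i ≠ j → 0 < W s(i, j)) →
      H22.negIntegral (H22.integrand W p f) < ⊤) ∧
    -- and it is non-increasing in each edge weight, the other ones being fixed
    (∀ W : H22.Weight N, (∀ i j, i ≠ j → 0 < W s(i, j)) → ∀ i j : H22.Vertex N,
      AntitoneOn (fun w : ℝ => H22.K p f (Function.update W s(i, j) w)) (Set.Ioi 0)) := by
  refine ⟨fun W hW => H22.negIntegral_integrand_lt_top hW hp hf, fun W hW i j w₁ h₁ w₂ h₂ h => ?_⟩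
  have hfin := fun (w : ℝ) (hw : 0 < w) => H22.negIntegral_integrand_lt_top
    (H22.update_pos_of_pos hW s(i, j) hw) hp hf
  refine H22.extIntegral_le_of_add_le (hfin w₁ h₁) (hfin w₂ h₂) ?_
  simp only [← H22.fieldIntegrand_perspective]
  exact H22.isMonotoneEdge hW (H22.convexOn_perspective p hf)
    (fun s hs x _ => H22.perspective_smul p f s hs x) i j w₁ w₂ h₁ h
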